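/- Let $p\in(0,1)$ be a constant. For $n\ge 1$ let $G_p\in\mathcal G_{n,p}$ be the Erdős–Rényi random graph on $n$ labelled vertices, in which each of the $\binom n2$ possible edges is present independently with probability $p$. For a graph $G$ with vertex set $\{1,\dots,n\}$ let $d_i$ be the degree of vertex $i$ and $D(i,j)$ the distance between $i$ and $j$ in $G$ (with the convention $D(i,j)=0$ if $i$ and $j$ lie in different components), and let the Gutman matrix $Gut(G)$ be the real symmetric $n\times n$ matrix with entries $$Gut(G)(i,j)=d_i\,d_j\,D(i,j).$$ Let $\mathscr E(Gut(G))=\sum_{i=1}^n|\lambda_i|$ be its energy, where $\lambda_1,\dots,\lambda_n$ are the eigenvalues of $Gut(G)$ counted with multiplicity. Then, with probability tending to $1$ as $n\to\infty$, $$\mathscr E(Gut(G_p))=\Bigl(\frac{8}{3\pi}\,p^{2}\sqrt{p(1-p)}+o(1)\Bigr)\,n^{7/2},$$ that is, for every $\varepsilon>0$, $$\lim_{n\to\infty}\mathbb P\left(\left|\mathscr E(Gut(G_p))-\frac{8}{3\pi}\,p^{2}\sqrt{p(1-p)}\;n^{7/2}\right|\le\varepsilon\, n^{7/2}\right)=1.$$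 -/

import Mathlib

noncomputable section

namespace WeightedDistance

/-- The energy of a real symmetric matrix: the sum of the absolute values of its eigenvalues,
counted with multiplicity. -/
def energy {V : Type*} [Fintype V] [DecidableEq V] (A : Matrix V V ℝ) (hA : A.IsHermitian) : ℝ :=
  ∑ i, |hA.eigenvalues i|

open Classical in
/-- The Gutman matrix of a finite simple graph: the entry at `(i, j)` is `d_i * d_j * D(i, j)`.
The diagonal vanishes since `D(i, i) = 0`. For vertices in different components `G.dist` is `0`
by convention. -/
def gutmanMatrix {V : Type*} [Fintype V] (G : SimpleGraph V) : Matrix V V ℝ :=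
  Matrix.of fun i j => (G.degree i : ℝ) * (G.degree j : ℝ) * (G.dist i j : ℝ)

theorem gutmanMatrix_isHermitian {V : Type*} [Fintype V] (G : SimpleGraph V) :
    (gutmanMatrix G).IsHermitian := by
  ext i j
  simp only [gutmanMatrix, Matrix.conjTranspose_apply, Matrix.of_apply, star_trivial,
    G.dist_comm (u := j) (v := i)]
  ring

/-- The energy of the Gutman matrix of a finite simple graph. -/
def gutmanEnergy {V : Type*} [Fintype V] [DecidableEq V] (G : SimpleGraph V) : ℝ :=
  energy (gutmanMatrix G) (gutmanMatrix_isHermitian G)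

end WeightedDistance

end

/-! For fixed `p`, any two distinct vertices are with high probability adjacent or joined by a
common neighbour. Then distances are `1` or `2` off the diagonal, hence affine in the adjacency
matrix, and the Gutman matrix is `D((2 - p)(J - I) - w)D`, where `D` is the diagonal degree matrix,
`J` the all-ones matrix and `w` the centred adjacency matrix.

The energy is the trace norm, that is, the maximum of `tr(AQ)` over orthogonal `Q`. Paired with such
a `Q`, the rank-one and diagonal pieces contribute `O(n^3)`, and replacing `D` by `np` costs
`O(n^(3/2))` times the total degree deviation, again `O(n^3)` in mean. All this is below `n^(7/2)`,
so the energy is asymptotically `(np)^2 √n` times that of the Wigner matrix `w / √n`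
(`abs_energy_sub_le`, `abs_trace_weighted_le`).

It remains to prove the semicircle law in the form: the energy of `w / √n`, divided by `n`, tends in
mean to `8/(3π) √v`, with `v = p(1 - p)`. Coulson's formula `|x| = (2/π) ∫ x²/(x² + t²) dt` over `t
> 0` expresses the energy through the normalised resolvent trace `s` at the points `it`. The Schur
complement formula, concentration of quadratic forms in a row and the small effect of erasing a row
give `1 + it s + v s² → 0` in mean (`expect_selfConsistent_le`). The quadratic is stable on the
imaginary axis (`abs_im_sub_le`), so the integrands converge for each `t`, and dominated convergence
applies. Markov's inequality turns convergence in mean into the probability statement. -/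

namespace WeightedDistance

open SimpleGraph MeasureTheory unitInterval

/-! ### Centred adjacency matrices and independence of a pair -/

section Centered

variable {V : Type*}

theorem sup_edge_adj_iff (Γ : SimpleGraph V) {i j k l : V} (h : s(i, j) ≠ s(k, l)) :
    (Γ ⊔ edge i j).Adj k l ↔ Γ.Adj k l := by
  rw [sup_adj, adj_edge]
  tauto

theorem sup_edge_adj_self (Γ : SimpleGraph V) {i j : V} (h : i ≠ j) : (Γ ⊔ edge i j).Adj i j := by
  simp [sup_adj, adj_edge, h]

open Classical in
/-- The centred adjacency matrix: `1 - p` on edges, `-p` on non-edges, `0` on the diagonal. -/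
noncomputable def centered (p : ℝ) (Γ : SimpleGraph V) : Matrix V V ℝ :=
  Matrix.of fun i j => if i = j then 0 else (if Γ.Adj i j then 1 else 0) - p

variable (p : ℝ) (Γ : SimpleGraph V)

@[simp] theorem centered_self (i : V) : centered p Γ i i = 0 := by simp [centered]

theorem centered_comm (i j : V) : centered p Γ i j = centered p Γ j i := by
  rcases eq_or_ne i j with rfl | hij
  · rfl
  · by_cases h : Γ.Adj i j
    · simp [centered, h, h.symm, hij, hij.symm]
    · have h' : ¬ Γ.Adj j i := fun h' => h h'.symm
      simp [centered, h, h', hij, hij.symm]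

theorem centered_of_adj {i j : V} (h : Γ.Adj i j) : centered p Γ i j = 1 - p := by
  simp [centered, h, h.ne]

theorem centered_of_not_adj {i j : V} (hij : i ≠ j) (h : ¬ Γ.Adj i j) :
    centered p Γ i j = -p := by
  simp [centered, h, hij]

theorem abs_centered_le (p : I) (i j : V) : |centered (p : ℝ) Γ i j| ≤ 1 := by
  have h0 := p.2.1
  have h1 := p.2.2
  rcases eq_or_ne i j with rfl | hij
  · simp
  · by_cases h : Γ.Adj i j
    · rw [centered_of_adj _ _ h, abs_le]; constructor <;> linarith
    · rw [centered_of_not_adj _ _ hij h, abs_le]; constructor <;> linarith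

theorem centered_sup_edge {i j k l : V} (h : s(i, j) ≠ s(k, l)) :
    centered p (Γ ⊔ edge i j) k l = centered p Γ k l := by
  simp only [centered, Matrix.of_apply]
  congr! 3
  exact (sup_edge_adj_iff Γ h)

/-- A parameter that does not depend on the status of the pair `i`, `j`. -/
def IgnoresEdge {α : Type*} (i j : V) (F : SimpleGraph V → α) : Prop :=
  ∀ Γ : SimpleGraph V, ¬ Γ.Adj i j → F (Γ ⊔ edge i j) = F Γ

end Centered

/-! ### Expectation over the random graph and resampling of one edge -/

section Expectation

variable {V : Type*} [Fintype V] [DecidableEq V] (p : I)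

instance : MeasurableSingletonClass (SimpleGraph V) where
  measurableSet_singleton Γ := by
    have h := (measurableEmbedding_edgeSet (V := V)).measurable (measurableSet_singleton Γ.edgeSet)
    convert h using 1
    ext Γ'
    simp

/-- The expectation of a real-valued graph parameter over the binomial random graph. -/
noncomputable def expect (F : SimpleGraph V → ℝ) : ℝ :=
  ∑ Γ, (binomialRandom V p).real {Γ} * F Γ

theorem expect_add (F F' : SimpleGraph V → ℝ) :
    expect p (fun Γ => F Γ + F' Γ) = expect p F + expect p F' := by
  simp only [expect, mul_add, Finset.sum_add_distrib]

theorem expect_const_mul (c : ℝ) (F : SimpleGraph V → ℝ) :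
    expect p (fun Γ => c * F Γ) = c * expect p F := by
  simp only [expect, Finset.mul_sum]
  exact Finset.sum_congr rfl fun _ _ => by ring

theorem expect_sub (F F' : SimpleGraph V → ℝ) :
    expect p (fun Γ => F Γ - F' Γ) = expect p F - expect p F' := by
  simp only [expect, mul_sub, Finset.sum_sub_distrib]

theorem expect_sum {ι : Type*} (s : Finset ι) (F : ι → SimpleGraph V → ℝ) :
    expect p (fun Γ => ∑ a ∈ s, F a Γ) = ∑ a ∈ s, expect p (F a) := by
  simp only [expect, Finset.mul_sum]
  exact Finset.sum_comm

theorem expect_mono {F F' : SimpleGraph V → ℝ} (h : ∀ Γ, F Γ ≤ F' Γ) :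
    expect p F ≤ expect p F' :=
  Finset.sum_le_sum fun Γ _ => mul_le_mul_of_nonneg_left (h Γ) measureReal_nonneg

theorem expect_nonneg {F : SimpleGraph V → ℝ} (h : ∀ Γ, 0 ≤ F Γ) : 0 ≤ expect p F :=
  Finset.sum_nonneg fun Γ _ => mul_nonneg measureReal_nonneg (h Γ)

theorem expect_const (c : ℝ) : expect p (fun _ : SimpleGraph V => c) = c := by
  rw [expect, ← Finset.sum_mul, sum_measureReal_singleton]
  simp

open Classical in
theorem measureReal_eq_expect (S : Set (SimpleGraph V)) :
    (binomialRandom V p).real S = expect p (fun Γ => if Γ ∈ S then 1 else 0) := by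
  have h : S = ((Finset.univ.filter (· ∈ S) : Finset (SimpleGraph V)) : Set (SimpleGraph V)) := by
    ext; simp
  conv_lhs => rw [h]
  rw [← sum_measureReal_singleton, Finset.sum_filter]
  exact Finset.sum_congr rfl fun Γ _ => by split_ifs with h' <;> simp [h']

/-- Markov's inequality. -/
theorem measureReal_le_expect_div {F : SimpleGraph V → ℝ} (h : ∀ Γ, 0 ≤ F Γ) {a : ℝ} (ha : 0 < a) :
    (binomialRandom V p).real {Γ | a < F Γ} ≤ expect p F / a := by
  rw [measureReal_eq_expect, div_eq_inv_mul, ← expect_const_mul]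
  refine expect_mono p fun Γ => ?_
  split_ifs with h'
  · rw [← div_eq_inv_mul, one_le_div ha]; exact le_of_lt h'
  · exact mul_nonneg (inv_nonneg.2 ha.le) (h Γ)

/-- AM–GM in place of Cauchy–Schwarz; `a` is the expected size of `F`, below always `√n`. -/
theorem expect_abs_le {a : ℝ} (ha : 0 < a) (F : SimpleGraph V → ℝ) :
    expect p (fun Γ => |F Γ|) ≤ (a + expect p (fun Γ => F Γ ^ 2) / a) / 2 := by
  have h : ∀ Γ, |F Γ| ≤ a / 2 + (2 * a)⁻¹ * F Γ ^ 2 := fun Γ => by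
    have h1 := sq_nonneg (|F Γ| - a)
    rw [← sq_abs (F Γ)]
    field_simp
    nlinarith
  refine (expect_mono p h).trans ?_
  rw [expect_add, expect_const, expect_const_mul]
  apply le_of_eq
  field_simp

/-- Adding an edge trades a factor `1 - p` for `p`. The cross-multiplied form needs no exclusion of
`p = 0` or `p = 1`. -/
theorem binomialRandom_real_sup_edge (Γ : SimpleGraph V) {i j : V} (hij : i ≠ j)
    (h : ¬ Γ.Adj i j) :
    (binomialRandom V p).real {Γ ⊔ edge i j} * (1 - p) = (binomialRandom V p).real {Γ} * p := by
  have hc : (Γ ⊔ edge i j).edgeSet.ncard = Γ.edgeSet.ncard + 1 := by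
    rw [edgeSet_sup, edgeSet_edge_of_ne hij, Set.union_singleton, Set.ncard_insert_of_notMem]
    simpa using h
  have hle : (Γ ⊔ edge i j).edgeSet.ncard ≤ (Nat.card V).choose 2 := by
    classical
    rw [Nat.card_eq_fintype_card, Set.ncard_eq_toFinset_card']
    exact card_edgeFinset_le_card_choose_two (G := Γ ⊔ edge i j)
  rw [hc] at hle
  simp only [measureReal_def, binomialRandom_singleton, hc]
  obtain ⟨m, hm⟩ := Nat.exists_eq_add_of_le hle
  rw [hm, show Γ.edgeSet.ncard + 1 + m - (Γ.edgeSet.ncard + 1) = m by omega,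
    show Γ.edgeSet.ncard + 1 + m - Γ.edgeSet.ncard = m + 1 by omega]
  simp only [ENNReal.toReal_mul, ENNReal.toReal_pow, pow_succ, ENNReal.coe_toReal,
    coe_toNNReal, coe_symm_eq]
  ring

/-- Resampling a single edge: the expectation vanishes as soon as the average over that edge
does. -/
theorem expect_eq_zero {i j : V} (hij : i ≠ j) (F : SimpleGraph V → ℝ)
    (h : ∀ Γ : SimpleGraph V, ¬ Γ.Adj i j → p * F (Γ ⊔ edge i j) + (1 - p) * F Γ = 0) :
    expect p F = 0 := by
  classical
  -- Graphs with and without the edge are in bijection, so the expectation becomes a sum over the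
  -- pairs `Γ`, `Γ ⊔ edge i j`.
  have hbij : ∑ Γ : SimpleGraph V with Γ.Adj i j, (binomialRandom V p).real {Γ} * F Γ
      = ∑ Γ : SimpleGraph V with ¬ Γ.Adj i j,
          (binomialRandom V p).real {Γ ⊔ edge i j} * F (Γ ⊔ edge i j) := by
    refine Finset.sum_nbij' (fun Γ => Γ \ edge i j) (fun Γ => Γ ⊔ edge i j) ?_ ?_ ?_ ?_ ?_
    · intro Γ hΓ
      simp [adj_edge, hij]
    · intro Γ hΓ
      simpa using sup_edge_adj_self Γ hij
    · intro Γ hΓ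
      have hΓ' : Γ.Adj i j := by simpa using hΓ
      exact sdiff_sup_cancel ((edge_le_iff Γ).2 (Or.inr hΓ'))
    · intro Γ hΓ
      have hΓ' : ¬ Γ.Adj i j := by simpa using hΓ
      rw [sup_sdiff_right_self, sdiff_edge Γ hΓ']
    · intro Γ hΓ
      have hΓ' : Γ.Adj i j := by simpa using hΓ
      simp only [sdiff_sup_cancel ((edge_le_iff Γ).2 (Or.inr hΓ'))]
  rw [expect, ← Finset.sum_filter_add_sum_filter_not _ (fun Γ : SimpleGraph V => Γ.Adj i j), hbij,
    ← Finset.sum_add_distrib]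
  refine Finset.sum_eq_zero fun Γ hΓ => ?_
  have hΓ' : ¬ Γ.Adj i j := by simpa using hΓ
  have h1 := binomialRandom_real_sup_edge p Γ hij hΓ'
  have h2 := h Γ hΓ'
  -- For `p > 0` the goal is multiplied by `p`. For `p = 0` the hypothesis forces `F Γ = 0` and the
  -- larger graph has weight `0`.
  rcases eq_or_ne (p : ℝ) 0 with hp | hp
  · simp only [hp] at h1 h2
    have h3 : F Γ = 0 := by linarith
    have h4 : (binomialRandom V p).real {Γ ⊔ edge i j} = 0 := by linarith
    simp [h3, h4]
  · rw [← mul_left_cancel_iff_of_pos (lt_of_le_of_ne p.2.1 (Ne.symm hp)), mul_zero]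
    linear_combination (-F Γ) * h1 + (binomialRandom V p).real {Γ ⊔ edge i j} * h2

end Expectation

/-! ### Moments of linear and quadratic forms in one row -/

section Row

variable {V : Type*} [Fintype V] [DecidableEq V]

/-- Given all other pairs, the entry is `1 - p` with probability `p` and `-p` otherwise, so `hf`
says that `f` of it has conditional mean zero. -/
theorem expect_mul_eq_zero (p : I) {i j : V} (hij : i ≠ j) (f : ℝ → ℝ)
    (hf : p * f (1 - p) + (1 - p) * f (-p) = 0)
    {F : SimpleGraph V → ℝ} (hF : IgnoresEdge i j F) :
    expect p (fun Γ => f (centered p Γ i j) * F Γ) = 0 := by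
  refine expect_eq_zero p hij _ fun Γ hΓ => ?_
  rw [hF Γ hΓ, centered_of_adj _ _ (sup_edge_adj_self Γ hij), centered_of_not_adj _ _ hij hΓ]
  linear_combination F Γ * hf

theorem expect_centered_mul (p : I) {i j : V} (hij : i ≠ j)
    {F : SimpleGraph V → ℝ} (hF : IgnoresEdge i j F) :
    expect p (fun Γ => centered p Γ i j * F Γ) = 0 :=
  expect_mul_eq_zero p hij id (by simp only [id]; ring) hF

theorem expect_centered_sq_mul (p : I) {i j : V} (hij : i ≠ j)
    {F : SimpleGraph V → ℝ} (hF : IgnoresEdge i j F) :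
    expect p (fun Γ => centered p Γ i j ^ 2 * F Γ) = p * (1 - p) * expect p F := by
  have h := expect_mul_eq_zero p hij (fun x => x ^ 2 - p * (1 - p)) (by ring) hF
  simp only [sub_mul, expect_sub, expect_const_mul] at h
  linarith

theorem expect_centered_sq_sub_mul (p : I) {i j : V} (hij : i ≠ j)
    {F : SimpleGraph V → ℝ} (hF : IgnoresEdge i j F) :
    expect p (fun Γ => (centered p Γ i j ^ 2 - p * (1 - p)) * F Γ) = 0 :=
  expect_mul_eq_zero p hij (fun x => x ^ 2 - p * (1 - p)) (by ring) hF

/-- Orthogonality of the entries of a row, with coefficients not depending on the row. -/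
theorem expect_linear_sq (p : I) (i : V) (S : Finset V) (hi : i ∉ S)
    (a : V → SimpleGraph V → ℝ) (ha : ∀ k l, k ∈ S → IgnoresEdge i k (a l)) :
    expect p (fun Γ => (∑ k ∈ S, centered p Γ i k * a k Γ) ^ 2)
      = p * (1 - p) * ∑ k ∈ S, expect p (fun Γ => a k Γ ^ 2) := by
  induction S using Finset.induction_on with
  | empty => simp [expect]
  | insert m S hm ih =>
    have him : i ≠ m := fun h => hi (by simp [h])
    have hiS : i ∉ S := fun h => hi (by simp [h])
    have h1 := expect_centered_sq_mul p him (F := fun Γ => a m Γ ^ 2)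
      (fun Γ hΓ => by simp only [ha m m (by simp) Γ hΓ])
    have h2 := expect_centered_mul p him
      (F := fun Γ => a m Γ * ∑ k ∈ S, centered p Γ i k * a k Γ) (fun Γ hΓ => by
        simp only [ha m _ (Finset.mem_insert_self m S) Γ hΓ]
        congr 1
        refine Finset.sum_congr rfl fun k hk => ?_
        rw [centered_sup_edge]
        intro h
        rw [Sym2.congr_right] at h
        exact hm (h ▸ hk))
    rw [Finset.sum_insert hm, mul_add, ← ih hiS (fun k l hk => ha k l (by simp [hk])), ← h1]
    rw [← expect_add]
    rw [← sub_eq_zero, ← expect_sub]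
    rw [← mul_zero 2, ← h2, ← expect_const_mul]
    congr 1
    ext Γ
    rw [Finset.sum_insert hm]
    ring

/-- Concentration of quadratic forms in a row, with coefficients not depending on the row. -/
theorem expect_quadratic_sq_le (p : I) (i : V) (S : Finset V) (hi : i ∉ S)
    (M : V → V → SimpleGraph V → ℝ) (hM : ∀ m k l, m ∈ S → IgnoresEdge i m (M k l)) :
    expect p (fun Γ => (∑ k ∈ S, ∑ l ∈ S, centered p Γ i k * centered p Γ i l * M k l Γ
        - p * (1 - p) * ∑ k ∈ S, M k k Γ) ^ 2)
      ≤ 4 * ∑ k ∈ S, ∑ l ∈ S, expect p (fun Γ => M k l Γ ^ 2) := by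
  have hp0 := p.2.1
  have hp1 := p.2.2
  have hv0 : 0 ≤ (p : ℝ) * (1 - p) := mul_nonneg hp0 (by linarith)
  have hv1 : (p : ℝ) * (1 - p) ≤ 1 := by nlinarith
  induction S using Finset.induction_on with
  | empty => simp [expect]
  | insert m S hm ih =>
    have him : i ≠ m := fun h => hi (by simp [h])
    have hiS : i ∉ S := fun h => hi (by simp [h])
    have hne : ∀ k ∈ S, s(i, m) ≠ s(i, k) := fun k hk h => by
      rw [Sym2.congr_right] at h
      exact hm (h ▸ hk)
    have hM' : ∀ k l, IgnoresEdge i m (M k l) := fun k l => hM m k l (by simp)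
    have ih' := ih hiS (fun m k l hk => hM m k l (by simp [hk]))
    set Q : SimpleGraph V → ℝ := fun Γ =>
      ∑ k ∈ S, ∑ l ∈ S, centered p Γ i k * centered p Γ i l * M k l Γ
        - p * (1 - p) * ∑ k ∈ S, M k k Γ with hQ
    set L : SimpleGraph V → ℝ := fun Γ =>
      ∑ k ∈ S, centered p Γ i k * (M m k Γ + M k m Γ) with hL
    have hQi : IgnoresEdge i m Q := fun Γ hΓ => by
      simp only [hQ, hM' _ _ Γ hΓ]
      congr 1
      refine Finset.sum_congr rfl fun k hk => Finset.sum_congr rfl fun l hl => ?_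
      rw [centered_sup_edge _ _ (hne k hk), centered_sup_edge _ _ (hne l hl)]
    have hLi : IgnoresEdge i m L := fun Γ hΓ => by
      simp only [hL, hM' _ _ Γ hΓ]
      refine Finset.sum_congr rfl fun k hk => ?_
      rw [centered_sup_edge _ _ (hne k hk)]
    -- Adjoining `m` to `S` adds a term linear in the new entry and a centred square. Since `Q` and
    -- `L` do not see the pair `i`, `m`, the products of `Q` with both increments have mean zero.
    have hexp : ∀ Γ, ∑ k ∈ insert m S, ∑ l ∈ insert m S,
          centered p Γ i k * centered p Γ i l * M k l Γ
          - p * (1 - p) * ∑ k ∈ insert m S, M k k Γ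
        = Q Γ + centered p Γ i m * L Γ
          + (centered p Γ i m ^ 2 - p * (1 - p)) * M m m Γ := fun Γ => by
      simp only [Finset.sum_insert hm, Finset.sum_add_distrib, hQ, hL, mul_add]
      have e1 : ∑ l ∈ S, centered p Γ i m * centered p Γ i l * M m l Γ
          = centered p Γ i m * ∑ l ∈ S, centered p Γ i l * M m l Γ := by
        rw [Finset.mul_sum]; exact Finset.sum_congr rfl fun _ _ => by ring
      have e2 : ∑ l ∈ S, centered p Γ i l * centered p Γ i m * M l m Γ
          = centered p Γ i m * ∑ l ∈ S, centered p Γ i l * M l m Γ := by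
        rw [Finset.mul_sum]; exact Finset.sum_congr rfl fun _ _ => by ring
      rw [e1, e2]
      ring
    simp only [hexp]
    have c1 := expect_centered_mul p him (F := fun Γ => Q Γ * L Γ)
      (fun Γ hΓ => by simp only [hQi Γ hΓ, hLi Γ hΓ])
    have c2 := expect_centered_sq_sub_mul p him (F := fun Γ => Q Γ * M m m Γ)
      (fun Γ hΓ => by simp only [hQi Γ hΓ, hM' _ _ Γ hΓ])
    have c3 := expect_centered_sq_mul p him (F := fun Γ => L Γ ^ 2)
      (fun Γ hΓ => by simp only [hLi Γ hΓ])
    have c4 : expect p (fun Γ => L Γ ^ 2) ≤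
        ∑ k ∈ S, (2 * expect p (fun Γ => M m k Γ ^ 2) + 2 * expect p (fun Γ => M k m Γ ^ 2)) := by
      rw [hL, expect_linear_sq p i S hiS (fun k Γ => M m k Γ + M k m Γ) (fun k l hk Γ hΓ => by
        simp only [hM k _ _ (Finset.mem_insert_of_mem hk) Γ hΓ])]
      refine (mul_le_of_le_one_left (Finset.sum_nonneg fun k _ =>
        expect_nonneg p fun Γ => sq_nonneg _) hv1).trans (Finset.sum_le_sum fun k _ => ?_)
      rw [← expect_const_mul, ← expect_const_mul, ← expect_add]
      exact expect_mono p fun Γ => by nlinarith [sq_nonneg (M m k Γ - M k m Γ)]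
    have hLnn : 0 ≤ expect p (fun Γ => L Γ ^ 2) := expect_nonneg p fun Γ => sq_nonneg _
    -- The two increments need not be orthogonal to each other; `(a + b)² ≤ 2a² + 2b²` separates
    -- them. Together with the factor `2` in `c4` this produces the constant `4`.
    have hbound : ∀ Γ, (Q Γ + centered p Γ i m * L Γ
          + (centered p Γ i m ^ 2 - p * (1 - p)) * M m m Γ) ^ 2
        ≤ Q Γ ^ 2 + 2 * (centered p Γ i m * (Q Γ * L Γ))
          + 2 * ((centered p Γ i m ^ 2 - p * (1 - p)) * (Q Γ * M m m Γ))
          + 2 * (centered p Γ i m ^ 2 * L Γ ^ 2) + 2 * M m m Γ ^ 2 := fun Γ => by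
      have hw := abs_centered_le Γ p i m
      have hw2 : centered p Γ i m ^ 2 ≤ 1 := by
        rw [← sq_abs]; exact pow_le_one₀ (abs_nonneg _) hw
      have hx : (centered p Γ i m ^ 2 - p * (1 - p)) ^ 2 ≤ 1 := by
        rw [sq_le_one_iff_abs_le_one, abs_le]
        constructor <;> nlinarith [sq_nonneg (centered p Γ i m)]
      have h3 : (centered p Γ i m ^ 2 - p * (1 - p)) ^ 2 * M m m Γ ^ 2 ≤ M m m Γ ^ 2 :=
        mul_le_of_le_one_left (sq_nonneg _) hx
      nlinarith [sq_nonneg (centered p Γ i m * L Γ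
          - (centered p Γ i m ^ 2 - p * (1 - p)) * M m m Γ)]
    refine (expect_mono p hbound).trans ?_
    simp only [expect_add, expect_const_mul, c1, c2, c3]
    simp only [Finset.sum_insert hm, Finset.sum_add_distrib, ← Finset.mul_sum] at c4 ⊢
    have hmm : 0 ≤ expect p (fun Γ => M m m Γ ^ 2) := expect_nonneg p fun Γ => sq_nonneg _
    nlinarith [mul_le_of_le_one_left hLnn hv1]

end Row

end WeightedDistance

namespace WeightedDistance

open Matrix

/-! ### Energy as a maximum of pairings with orthogonal matrices -/

section Energy

variable {V : Type*} [Fintype V] [DecidableEq V]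

theorem sum_sq_col_eq_one {Q : Matrix V V ℝ} (hQ : Qᵀ * Q = 1) (i : V) : ∑ k, Q k i ^ 2 = 1 := by
  have h := congrFun (congrFun hQ i) i
  rw [mul_apply, one_apply_eq] at h
  rw [← h]
  exact Finset.sum_congr rfl fun k _ => by rw [transpose_apply, sq]

theorem sum_sq_row_eq_one {Q : Matrix V V ℝ} (hQ : Qᵀ * Q = 1) (i : V) : ∑ k, Q i k ^ 2 = 1 := by
  have hQ' : Qᵀᵀ * Qᵀ = 1 := by rw [transpose_transpose]; exact mul_eq_one_comm.1 hQ
  exact sum_sq_col_eq_one hQ' i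

theorem abs_apply_le_one {Q : Matrix V V ℝ} (hQ : Qᵀ * Q = 1) (i j : V) : |Q i j| ≤ 1 := by
  rw [← sq_le_one_iff_abs_le_one, ← sum_sq_col_eq_one hQ j]
  exact Finset.single_le_sum (f := fun k => Q k j ^ 2) (fun k _ => sq_nonneg _) (Finset.mem_univ i)

theorem exists_orthogonal_diagonal {A : Matrix V V ℝ} (hA : A.IsHermitian) :
    ∃ U : Matrix V V ℝ, Uᵀ * U = 1 ∧ A = U * diagonal hA.eigenvalues * Uᵀ := by
  refine ⟨hA.eigenvectorUnitary, ?_, ?_⟩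
  · have h := (mem_unitaryGroup_iff' (A := (hA.eigenvectorUnitary : Matrix V V ℝ))).1
      hA.eigenvectorUnitary.2
    rwa [star_eq_conjTranspose, conjTranspose_eq_transpose_of_trivial] at h
  · have h := hA.spectral_theorem
    rw [Unitary.conjStarAlgAut_apply] at h
    rw [← conjTranspose_eq_transpose_of_trivial, ← star_eq_conjTranspose]
    exact h

/-- The energy dominates the pairing with any orthogonal matrix. -/
theorem abs_trace_mul_le_energy {A : Matrix V V ℝ} (hA : A.IsHermitian) {Q : Matrix V V ℝ}
    (hQ : Qᵀ * Q = 1) : |(A * Q).trace| ≤ energy A hA := by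
  obtain ⟨U, hU, h⟩ := exists_orthogonal_diagonal hA
  have h1 : (A * Q).trace = (diagonal hA.eigenvalues * (Uᵀ * Q * U)).trace := by
    conv_lhs => rw [h]
    rw [Matrix.mul_assoc, Matrix.mul_assoc, trace_mul_comm]
    simp only [Matrix.mul_assoc]
  have hU' : U * Uᵀ = 1 := mul_eq_one_comm.1 hU
  have h2 : (Uᵀ * Q * U)ᵀ * (Uᵀ * Q * U) = 1 := by
    calc (Uᵀ * Q * U)ᵀ * (Uᵀ * Q * U) = Uᵀ * (Qᵀ * ((U * Uᵀ) * Q)) * U := by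
          simp only [transpose_mul, transpose_transpose, Matrix.mul_assoc]
      _ = 1 := by rw [hU', Matrix.one_mul, hQ, Matrix.mul_one, hU]
  rw [h1, trace, energy]
  refine (Finset.abs_sum_le_sum_abs _ _).trans (Finset.sum_le_sum fun i _ => ?_)
  rw [diag_apply, diagonal_mul, abs_mul]
  exact mul_le_of_le_one_right (abs_nonneg _) (abs_apply_le_one h2 i i)

/-- The maximiser is the sign of `A`, formed in an eigenbasis. Zero eigenvalues get sign `1`, which
keeps it orthogonal. -/
theorem exists_orthogonal_trace_eq_energy {A : Matrix V V ℝ} (hA : A.IsHermitian) :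
    ∃ S : Matrix V V ℝ, Sᵀ * S = 1 ∧ (A * S).trace = energy A hA := by
  obtain ⟨U, hU, h⟩ := exists_orthogonal_diagonal hA
  set σ : V → ℝ := fun i => if 0 ≤ hA.eigenvalues i then 1 else -1 with hσ
  have hσσ : diagonal σ * diagonal σ = 1 := by
    rw [diagonal_mul_diagonal, ← diagonal_one]
    congr 1
    ext i
    simp only [hσ]
    split_ifs <;> norm_num
  have hU' : U * Uᵀ = 1 := mul_eq_one_comm.1 hU
  refine ⟨U * diagonal σ * Uᵀ, ?_, ?_⟩
  · calc (U * diagonal σ * Uᵀ)ᵀ * (U * diagonal σ * Uᵀ)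
          = U * (diagonal σ * ((Uᵀ * U) * diagonal σ)) * Uᵀ := by
            simp only [transpose_mul, transpose_transpose, diagonal_transpose, Matrix.mul_assoc]
      _ = 1 := by rw [hU, Matrix.one_mul, hσσ, Matrix.mul_one, hU']
  · calc (A * (U * diagonal σ * Uᵀ)).trace
          = (U * (diagonal hA.eigenvalues * ((Uᵀ * U) * (diagonal σ * Uᵀ)))).trace := by
            conv_lhs => rw [h]
            simp only [Matrix.mul_assoc]
      _ = energy A hA := by
          rw [hU, Matrix.one_mul, trace_mul_comm, Matrix.mul_assoc, Matrix.mul_assoc, hU,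
            Matrix.mul_one, diagonal_mul_diagonal, trace_diagonal, energy]
          refine Finset.sum_congr rfl fun i _ => ?_
          simp only [hσ]
          split_ifs with hi
          · rw [abs_of_nonneg hi, mul_one]
          · rw [abs_of_neg (not_le.1 hi)]; ring

/-- Comparison of energies through pairings with orthogonal matrices. -/
theorem abs_energy_sub_le {A B : Matrix V V ℝ} (hA : A.IsHermitian) (hB : B.IsHermitian)
    (c K : ℝ) (h : ∀ Q : Matrix V V ℝ, Qᵀ * Q = 1 → |((A - c • B) * Q).trace| ≤ K) :
    |energy A hA - |c| * energy B hB| ≤ K := by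
  have hsplit : ∀ Q : Matrix V V ℝ,
      ((A - c • B) * Q).trace = (A * Q).trace - c * (B * Q).trace := fun Q => by
    rw [Matrix.sub_mul, trace_sub, Matrix.smul_mul, trace_smul, smul_eq_mul]
  -- The maximiser for `A` bounds its energy from above, the maximiser for `B` bounds it from below.
  obtain ⟨S, hS, hSA⟩ := exists_orthogonal_trace_eq_energy hA
  obtain ⟨T, hT, hTB⟩ := exists_orthogonal_trace_eq_energy hB
  have h1 := abs_le.1 (h S hS)
  have h2 := abs_le.1 (h T hT)
  rw [hsplit] at h1 h2
  have h3 : |c * (B * S).trace| ≤ |c| * energy B hB := by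
    rw [abs_mul]
    exact mul_le_mul_of_nonneg_left (abs_trace_mul_le_energy hB hS) (abs_nonneg c)
  have h4 := abs_le.1 (abs_trace_mul_le_energy hA hT)
  have h3' := abs_le.1 h3
  rw [hSA] at h1
  rw [hTB] at h2
  rw [abs_le]
  constructor
  · rcases abs_cases c with ⟨hc, _⟩ | ⟨hc, _⟩ <;> rw [hc] <;> linarith
  · linarith

end Energy

/-! ### Replacing degrees by their common approximate value -/

section GutmanComparison

variable {V : Type*} [Fintype V] [DecidableEq V]

theorem abs_sum_mul_le_of_sq_le {ι : Type*} (s : Finset ι) (f g : ι → ℝ) {a b : ℝ} (ha : 0 ≤ a)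
    (hb : 0 ≤ b) (hf : ∑ k ∈ s, f k ^ 2 ≤ a ^ 2) (hg : ∑ k ∈ s, g k ^ 2 ≤ b ^ 2) :
    |∑ k ∈ s, f k * g k| ≤ a * b := by
  rw [← sq_le_sq₀ (abs_nonneg _) (mul_nonneg ha hb), sq_abs, mul_pow]
  exact (Finset.sum_mul_sq_le_sq_mul_sq s f g).trans
    (mul_le_mul hf hg (Finset.sum_nonneg fun _ _ => sq_nonneg _) (sq_nonneg a))

theorem abs_dotProduct_mulVec_le {Q : Matrix V V ℝ} (hQ : Qᵀ * Q = 1) (x : V → ℝ) {a : ℝ}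
    (ha : 0 ≤ a) (hx : ∑ i, x i ^ 2 ≤ a ^ 2) : |x ⬝ᵥ (Q *ᵥ x)| ≤ a * a := by
  refine abs_sum_mul_le_of_sq_le _ _ _ ha ha hx ?_
  have h : ∑ i, (Q *ᵥ x) i ^ 2 = ∑ i, x i ^ 2 := by
    have h1 : (Q *ᵥ x) ⬝ᵥ (Q *ᵥ x) = x ⬝ᵥ x := by
      rw [dotProduct_mulVec, ← mulVec_transpose, mulVec_mulVec, hQ, one_mulVec]
    simpa only [dotProduct, ← sq] using h1
  rw [h]; exact hx

/-- If `A` is a weighted distance matrix `d_i d_j (b (1 - δ_ij) - w_ij)`, then it is close to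
`-c² w` in energy when the `d_i` are close to `c`. -/
theorem abs_trace_weighted_le {Q : Matrix V V ℝ} (hQ : Qᵀ * Q = 1) {A w : Matrix V V ℝ}
    {d : V → ℝ} {b c N : ℝ} (hb0 : 0 ≤ b) (hb : b ≤ 2) (hN : (Fintype.card V : ℝ) = N ^ 2)
    (hN0 : 0 ≤ N) (hd0 : ∀ i, 0 ≤ d i) (hd : ∀ i, d i ≤ N ^ 2) (hc0 : 0 ≤ c) (hc : c ≤ N ^ 2)
    (hw : ∀ i j, |w i j| ≤ 1)
    (hA : ∀ i j, A i j = d i * d j * (b * (1 - if i = j then 1 else 0) - w i j)) :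
    |((A - (-c ^ 2) • w) * Q).trace| ≤ 4 * N ^ 6 + 2 * N ^ 3 * ∑ i, |d i - c| := by
  have hdd : ∀ i, d i ^ 2 ≤ (N ^ 2) ^ 2 := fun i => pow_le_pow_left₀ (hd0 i) (hd i) 2
  have hsumd : ∑ i, d i ^ 2 ≤ (N ^ 3) ^ 2 := by
    calc ∑ i, d i ^ 2 ≤ ∑ _i : V, (N ^ 2) ^ 2 := Finset.sum_le_sum fun i _ => hdd i
      _ = (N ^ 3) ^ 2 := by
        rw [Finset.sum_const, Finset.card_univ, nsmul_eq_mul, hN]; ring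
  -- The splitting is `d_i d_j w - c² w = (d_i - c) w d_j + c w (d_j - c)`. Each inner sum is then
  -- bounded by Cauchy–Schwarz against a unit row or column of `Q`. Here `N` plays the role of `√n`.
  have hexp : ((A - (-c ^ 2) • w) * Q).trace
      = b * (d ⬝ᵥ (Qᵀ *ᵥ d)) - b * ∑ i, d i ^ 2 * Q i i
        - ∑ i, (d i - c) * ∑ j, (w i j * d j) * Q j i
        - c * ∑ j, (d j - c) * ∑ i, w i j * Q j i := by
    have e1 : ∑ i, d i ^ 2 * Q i i = ∑ i, ∑ j, d i * d j * (if i = j then 1 else 0) * Q j i := by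
      refine Finset.sum_congr rfl fun i _ => ?_
      rw [Finset.sum_eq_single i]
      · rw [if_pos rfl]; ring
      · intro j _ hj; simp [hj.symm]
      · simp
    have e2 : ∑ j, (d j - c) * ∑ i, w i j * Q j i = ∑ i, ∑ j, (d j - c) * (w i j * Q j i) := by
      rw [Finset.sum_comm]
      simp only [Finset.mul_sum]
    rw [e1, e2]
    simp only [trace, diag_apply, mul_apply, Matrix.sub_apply, Matrix.smul_apply, smul_eq_mul, dotProduct,
      mulVec, transpose_apply, Finset.mul_sum, ← Finset.sum_sub_distrib, hA]
    refine Finset.sum_congr rfl fun i _ => Finset.sum_congr rfl fun j _ => ?_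
    ring
  have t1 : |d ⬝ᵥ (Qᵀ *ᵥ d)| ≤ N ^ 3 * N ^ 3 :=
    abs_dotProduct_mulVec_le (by rw [transpose_transpose]; exact mul_eq_one_comm.1 hQ) d
      (by positivity) hsumd
  have t2 : |∑ i, d i ^ 2 * Q i i| ≤ (N ^ 3) ^ 2 := by
    refine (Finset.abs_sum_le_sum_abs _ _).trans (le_trans (Finset.sum_le_sum fun i _ => ?_) hsumd)
    rw [abs_mul, abs_of_nonneg (sq_nonneg _)]
    exact mul_le_of_le_one_right (sq_nonneg _) (abs_apply_le_one hQ i i)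
  have t3 : ∀ i, |∑ j, (w i j * d j) * Q j i| ≤ N ^ 3 * 1 := fun i => by
    refine abs_sum_mul_le_of_sq_le _ _ _ (by positivity) zero_le_one ?_
      (by rw [sum_sq_col_eq_one hQ]; norm_num)
    refine le_trans (Finset.sum_le_sum fun j _ => ?_) hsumd
    rw [mul_pow]
    exact mul_le_of_le_one_left (sq_nonneg _) ((sq_le_one_iff_abs_le_one _).2 (hw i j))
  have t4 : ∀ j, |∑ i, w i j * Q j i| ≤ N * 1 := fun j => by
    refine abs_sum_mul_le_of_sq_le _ _ _ hN0 zero_le_one ?_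
      (by rw [sum_sq_row_eq_one hQ]; norm_num)
    calc ∑ i, w i j ^ 2 ≤ ∑ _i : V, (1 : ℝ) :=
          Finset.sum_le_sum fun i _ => (sq_le_one_iff_abs_le_one _).2 (hw i j)
      _ = N ^ 2 := by simp [hN]
  have t3' : |∑ i, (d i - c) * ∑ j, (w i j * d j) * Q j i| ≤ N ^ 3 * ∑ i, |d i - c| := by
    rw [Finset.mul_sum]
    refine (Finset.abs_sum_le_sum_abs _ _).trans (Finset.sum_le_sum fun i _ => ?_)
    rw [abs_mul, mul_comm]
    exact mul_le_mul_of_nonneg_right (by simpa using t3 i) (abs_nonneg _)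
  have t4' : |∑ j, (d j - c) * ∑ i, w i j * Q j i| ≤ N * ∑ i, |d i - c| := by
    rw [Finset.mul_sum]
    refine (Finset.abs_sum_le_sum_abs _ _).trans (Finset.sum_le_sum fun i _ => ?_)
    rw [abs_mul, mul_comm]
    exact mul_le_mul_of_nonneg_right (by simpa using t4 i) (abs_nonneg _)
  have t5 : |c * ∑ j, (d j - c) * ∑ i, w i j * Q j i| ≤ N ^ 3 * ∑ i, |d i - c| := by
    rw [abs_mul, abs_of_nonneg hc0]
    calc c * |∑ j, (d j - c) * ∑ i, w i j * Q j i| ≤ N ^ 2 * (N * ∑ i, |d i - c|) :=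
          mul_le_mul hc t4' (abs_nonneg _) (sq_nonneg N)
      _ = N ^ 3 * ∑ i, |d i - c| := by ring
  have t1' : |b * (d ⬝ᵥ (Qᵀ *ᵥ d))| ≤ 2 * N ^ 6 := by
    rw [abs_mul, abs_of_nonneg hb0]
    calc b * |d ⬝ᵥ (Qᵀ *ᵥ d)| ≤ 2 * (N ^ 3 * N ^ 3) :=
          mul_le_mul hb t1 (abs_nonneg _) zero_le_two
      _ = 2 * N ^ 6 := by ring
  have t2' : |b * ∑ i, d i ^ 2 * Q i i| ≤ 2 * N ^ 6 := by
    rw [abs_mul, abs_of_nonneg hb0]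
    calc b * |∑ i, d i ^ 2 * Q i i| ≤ 2 * (N ^ 3) ^ 2 :=
          mul_le_mul hb t2 (abs_nonneg _) zero_le_two
      _ = 2 * N ^ 6 := by ring
  rw [hexp]
  rw [abs_le] at *
  constructor <;> linarith [t1'.1, t1'.2, t2'.1, t2'.2, t3'.1, t3'.2, t5.1, t5.2]

end GutmanComparison

end WeightedDistance

namespace WeightedDistance

open SimpleGraph MeasureTheory unitInterval

/-! ### Degree deviations -/

section Degrees

variable {V : Type*} [Fintype V] [DecidableEq V]

open Classical in
theorem degree_eq_sum_centered (p : ℝ) (Γ : SimpleGraph V) (i : V) :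
    (Γ.degree i : ℝ)
      = ∑ j ∈ Finset.univ.erase i, centered p Γ i j + (Fintype.card V - 1) * p := by
  have h1 : (Γ.degree i : ℝ) = ∑ j ∈ Finset.univ.erase i, (centered p Γ i j + p) := by
    rw [← card_neighborFinset_eq_degree, neighborFinset_eq_filter, Finset.card_filter]
    push_cast
    rw [← Finset.add_sum_erase _ _ (Finset.mem_univ i)]
    simp only [Γ.irrefl, if_false, zero_add]
    refine Finset.sum_congr rfl fun j hj => ?_
    have hij : i ≠ j := (Finset.ne_of_mem_erase hj).symm
    by_cases h : Γ.Adj i j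
    · rw [centered_of_adj _ _ h]; simp [h]
    · rw [centered_of_not_adj _ _ hij h]; simp [h]
  rw [h1, Finset.sum_add_distrib, Finset.sum_const, Finset.card_erase_of_mem (Finset.mem_univ i),
    nsmul_eq_mul, Finset.card_univ, Nat.cast_pred (Fintype.card_pos_iff.2 ⟨i⟩)]

open Classical in
-- Orthogonality of the row entries bounds the variance by `n`; the extra `1` pays for centring at
-- `np` instead of `(n - 1)p`.
theorem expect_abs_degree_sub_le (p : I) (i : V) :
    expect p (fun Γ : SimpleGraph V => |(Γ.degree i : ℝ) - Fintype.card V * p|)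
      ≤ √(Fintype.card V) + 1 := by
  have hp0 := p.2.1
  have hp1 := p.2.2
  have hn : (0 : ℝ) < Fintype.card V := by exact_mod_cast Fintype.card_pos_iff.2 ⟨i⟩
  have hpt : ∀ Γ : SimpleGraph V, |(Γ.degree i : ℝ) - Fintype.card V * p|
      ≤ |∑ j ∈ Finset.univ.erase i, centered (p : ℝ) Γ i j| + 1 := fun Γ => by
    rw [degree_eq_sum_centered p]
    have : |-(p : ℝ)| ≤ 1 := by rw [abs_neg, abs_of_nonneg hp0]; exact hp1
    refine le_trans (le_of_eq ?_) ((abs_add_le _ _).trans (add_le_add_right this _))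
    congr 1; ring
  refine (expect_mono p hpt).trans ?_
  rw [expect_add, expect_const]
  refine add_le_add_left ((expect_abs_le p (Real.sqrt_pos.2 hn) _).trans ?_) 1
  have h := expect_linear_sq p i (Finset.univ.erase i) (by simp) (fun _ _ => 1)
    (fun _ _ _ _ _ => rfl)
  simp only [mul_one, one_pow, expect_const, Finset.sum_const, nsmul_eq_mul] at h
  rw [h, div_le_iff₀ zero_lt_two]
  have hcard : ((Finset.univ.erase i).card : ℝ) ≤ Fintype.card V := by
    exact_mod_cast Finset.card_le_univ _
  have hle : (p : ℝ) * (1 - p) * ((Finset.univ.erase i).card : ℝ) ≤ Fintype.card V := by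
    refine (mul_le_of_le_one_left (Nat.cast_nonneg _) ?_).trans hcard
    nlinarith
  have : (p : ℝ) * (1 - p) * ((Finset.univ.erase i).card : ℝ) / √(Fintype.card V)
      ≤ √(Fintype.card V) := by
    rw [div_le_iff₀ (Real.sqrt_pos.2 hn), Real.mul_self_sqrt hn.le]
    exact hle
  linarith

end Degrees

/-! ### Diameter two and its probability -/

section Diameter

variable {V : Type*}

/-- Any two distinct vertices are adjacent or have a common neighbour. -/
def DiamLeTwo (Γ : SimpleGraph V) : Prop :=
  ∀ i j, i ≠ j → Γ.Adj i j ∨ ∃ k, Γ.Adj i k ∧ Γ.Adj j k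

open Classical in
-- Off the diagonal the distance is `2` minus the adjacency indicator, that is, `(2 - p)` minus the
-- centred entry.
theorem DiamLeTwo.dist_eq {Γ : SimpleGraph V} (h : DiamLeTwo Γ) (p : ℝ) (i j : V) :
    (Γ.dist i j : ℝ) = (2 - p) * (1 - if i = j then 1 else 0) - centered p Γ i j := by
  rcases eq_or_ne i j with rfl | hij
  · simp
  · by_cases ha : Γ.Adj i j
    · rw [centered_of_adj _ _ ha, dist_eq_one_iff_adj.2 ha]
      simp [hij]; ring
    · obtain ⟨k, hik, hjk⟩ := (h i j hij).resolve_left ha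
      have hle : Γ.dist i j ≤ 2 :=
        dist_le (Walk.cons hik (Walk.cons hjk.symm Walk.nil))
      have h0 : Γ.dist i j ≠ 0 := by
        rw [Ne, dist_eq_zero_iff_eq_or_not_reachable]
        rintro (h | h)
        · exact hij h
        · exact h ⟨Walk.cons hik (Walk.cons hjk.symm Walk.nil)⟩
      have h1 : Γ.dist i j ≠ 1 := fun h => ha (dist_eq_one_iff_adj.1 h)
      have h2 : Γ.dist i j = 2 := by omega
      rw [centered_of_not_adj _ _ hij ha, h2]
      simp [hij]

variable [Fintype V] [DecidableEq V]

/-- The factor at `k` indicates that `k` is not a common neighbour. Expanded in the centred entries,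
each new factor keeps only its constant `1 - p²` in mean. -/
theorem expect_prod_no_common_neighbor (p : I) {i j : V} (hij : i ≠ j) (S : Finset V) (hi : i ∉ S)
    (hj : j ∉ S) :
    expect p (fun Γ => ∏ k ∈ S, (1 - (centered p Γ i k + p) * (centered p Γ j k + p)))
      = (1 - (p : ℝ) ^ 2) ^ S.card := by
  induction S using Finset.induction_on with
  | empty => simp [expect_const]
  | insert m S hm ih =>
    have him : i ≠ m := fun h => hi (by simp [h])
    have hjm : j ≠ m := fun h => hj (by simp [h])
    have hiS : i ∉ S := fun h => hi (by simp [h])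
    have hjS : j ∉ S := fun h => hj (by simp [h])
    set Φ : SimpleGraph V → ℝ := fun Γ =>
      ∏ k ∈ S, (1 - (centered p Γ i k + p) * (centered p Γ j k + p)) with hΦ
    have key : ∀ x, x ≠ m → IgnoresEdge x m Φ := fun x hx Γ _ => by
      simp only [hΦ]
      refine Finset.prod_congr rfl fun k hk => ?_
      have hkm : k ≠ m := fun h => hm (h ▸ hk)
      rw [centered_sup_edge, centered_sup_edge]
      · intro h
        rcases Sym2.eq_iff.1 h with ⟨-, h⟩ | ⟨-, h⟩
        · exact hkm h.symm
        · exact hjm h.symm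
      · intro h
        rcases Sym2.eq_iff.1 h with ⟨-, h⟩ | ⟨-, h⟩
        · exact hkm h.symm
        · exact him h.symm
    have hne : s(i, m) ≠ s(j, m) := fun h => by
      rw [Sym2.congr_left] at h
      exact hij h
    have c1 := expect_centered_mul p him (F := fun Γ => centered p Γ j m * Φ Γ) (fun Γ hΓ => by
      simp only [key i him Γ hΓ, centered_sup_edge p Γ hne])
    have c2 := expect_centered_mul p him (key i him)
    have c3 := expect_centered_mul p hjm (key j hjm)
    have hexp : ∀ Γ, ∏ k ∈ insert m S, (1 - (centered p Γ i k + p) * (centered p Γ j k + p))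
        = (1 - (p : ℝ) ^ 2) * Φ Γ - (centered p Γ i m * (centered p Γ j m * Φ Γ)
          + p * (centered p Γ i m * Φ Γ) + p * (centered p Γ j m * Φ Γ)) := fun Γ => by
      rw [Finset.prod_insert hm]; simp only [hΦ]; ring
    simp only [hexp]
    rw [expect_sub, expect_add, expect_add, expect_const_mul, expect_const_mul, expect_const_mul,
      c1, c2, c3, ih hiS hjS, Finset.card_insert_of_notMem hm, pow_succ]
    ring

/-- A union bound over ordered pairs, dropping the requirement of non-adjacency; each pair has `n -
2` possible common neighbours. -/
theorem measureReal_not_diamLeTwo_le (p : I) :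
    (binomialRandom V p).real {Γ | ¬ DiamLeTwo Γ}
      ≤ (Fintype.card V : ℝ) ^ 2 * (1 - (p : ℝ) ^ 2) ^ (Fintype.card V - 2) := by
  classical
  have hp0 := p.2.1
  have hp1 := p.2.2
  have hb : (0 : ℝ) ≤ 1 - (p : ℝ) ^ 2 := by nlinarith
  set S : V → V → Finset V := fun i j => (Finset.univ.erase i).erase j with hS
  set P : V → V → SimpleGraph V → ℝ := fun i j Γ =>
    if i = j then 0 else
      ∏ k ∈ S i j, (1 - (centered p Γ i k + p) * (centered p Γ j k + p)) with hP
  have hfac : ∀ (Γ : SimpleGraph V) (i j k : V), i ≠ k → j ≠ k →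
      1 - (centered (p : ℝ) Γ i k + p) * (centered (p : ℝ) Γ j k + p)
        = if Γ.Adj i k ∧ Γ.Adj j k then 0 else 1 := fun Γ i j k hi hj => by
    by_cases h1 : Γ.Adj i k <;> by_cases h2 : Γ.Adj j k <;>
      simp [h1, h2, centered_of_adj, centered_of_not_adj, hi, hj]
  have hPnn : ∀ i j Γ, 0 ≤ P i j Γ := fun i j Γ => by
    simp only [hP]
    split_ifs with hij
    · exact le_rfl
    · refine Finset.prod_nonneg fun k hk => ?_
      simp only [hS, Finset.mem_erase] at hk
      rw [hfac Γ i j k (Ne.symm hk.2.1) (Ne.symm hk.1)]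
      split_ifs <;> norm_num
  rw [measureReal_eq_expect]
  have hle : ∀ Γ : SimpleGraph V, @ite ℝ (Γ ∈ {Γ : SimpleGraph V | ¬ DiamLeTwo Γ})
      (Classical.propDecidable _) 1 0 ≤ ∑ i, ∑ j, P i j Γ := fun Γ => by
    split_ifs with h
    · simp only [Set.mem_ofPred_eq, DiamLeTwo, not_forall, not_or, not_exists] at h
      obtain ⟨i, j, hij, hadj, hk⟩ := h
      have h1 : P i j Γ = 1 := by
        simp only [hP, if_neg hij]
        refine Finset.prod_eq_one fun k hk' => ?_
        simp only [hS, Finset.mem_erase] at hk'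
        rw [hfac Γ i j k (Ne.symm hk'.2.1) (Ne.symm hk'.1), if_neg (hk k)]
      rw [← h1]
      exact (Finset.single_le_sum (f := fun j => P i j Γ) (fun j _ => hPnn i j Γ)
        (Finset.mem_univ j)).trans
        (Finset.single_le_sum (f := fun i => ∑ j, P i j Γ)
          (fun i _ => Finset.sum_nonneg fun j _ => hPnn i j Γ) (Finset.mem_univ i))
    · exact Finset.sum_nonneg fun i _ => Finset.sum_nonneg fun j _ => hPnn i j Γ
  refine (expect_mono p hle).trans ?_
  simp only [expect_sum]
  have hEP : ∀ i j, expect p (P i j) ≤ (1 - (p : ℝ) ^ 2) ^ (Fintype.card V - 2) := fun i j => by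
    by_cases hij : i = j
    · simp only [hP, if_pos hij, expect_const]
      exact pow_nonneg hb _
    · simp only [hP, if_neg hij]
      rw [expect_prod_no_common_neighbor p hij _ (by simp [hS]) (by simp [hS])]
      rw [hS, Finset.card_erase_of_mem (by simp [Ne.symm hij]),
        Finset.card_erase_of_mem (Finset.mem_univ i), Finset.card_univ, Nat.sub_sub]
  calc ∑ i, ∑ j, expect p (P i j)
      ≤ ∑ _i : V, ∑ _j : V, (1 - (p : ℝ) ^ 2) ^ (Fintype.card V - 2) :=
        Finset.sum_le_sum fun i _ => Finset.sum_le_sum fun j _ => hEP i j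
    _ = _ := by
      simp only [Finset.sum_const, Finset.card_univ, nsmul_eq_mul]; ring

end Diameter

end WeightedDistance

namespace WeightedDistance

open Matrix

/-! ### Resolvent bounds, Schur complement and erasure of a row -/

section Resolvent

variable {V : Type*} [Fintype V] [DecidableEq V]

/-- The matrix `H - i t`. -/
noncomputable def shifted {V : Type*} [DecidableEq V] (H : Matrix V V ℝ) (t : ℝ) : Matrix V V ℂ :=
  H.map Complex.ofReal - ((t : ℂ) * Complex.I) • 1

/-- The resolvent `(H - i t)⁻¹`. -/
noncomputable def resolvent (H : Matrix V V ℝ) (t : ℝ) : Matrix V V ℂ := (shifted H t)⁻¹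

theorem shifted_apply {V : Type*} [DecidableEq V] (H : Matrix V V ℝ) (t : ℝ) (k l : V) :
    shifted H t k l = (H k l : ℂ) - if k = l then t * Complex.I else 0 := by
  simp [shifted, one_apply]

theorem shifted_mulVec_apply (H : Matrix V V ℝ) (t : ℝ) (x : V → ℂ) (k : V) :
    (shifted H t *ᵥ x) k = ∑ l, (H k l : ℂ) * x l - t * Complex.I * x k := by
  simp only [mulVec, dotProduct, shifted_apply, sub_mul, Finset.sum_sub_distrib, ite_mul, zero_mul,
    Finset.sum_ite_eq, Finset.mem_univ, if_true]

theorem sub_mul_I_ne_zero (x : ℝ) {t : ℝ} (ht : 0 < t) : (x : ℂ) - t * Complex.I ≠ 0 := fun h => by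
  have := congrArg Complex.im h
  simp at this
  exact ht.ne' this

theorem shifted_mul_diagonalized {H : Matrix V V ℝ} {U : Matrix V V ℝ} (hU : Uᵀ * U = 1)
    {l : V → ℝ} (h : H = U * diagonal l * Uᵀ) {t : ℝ} (ht : 0 < t) :
    shifted H t * (U.map Complex.ofReal * diagonal (fun i => ((l i : ℂ) - t * Complex.I)⁻¹)
      * (U.map Complex.ofReal)ᵀ) = 1 := by
  set W : Matrix V V ℂ := U.map Complex.ofReal with hW
  have hW1 : Wᵀ * W = 1 := by
    have := congrArg (fun A : Matrix V V ℝ => A.map Complex.ofRealHom) hU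
    simp only [Matrix.map_mul, transpose_map] at this
    rw [Matrix.map_one _ (map_zero _) (map_one _)] at this
    exact this
  have hW2 : W * Wᵀ = 1 := mul_eq_one_comm.1 hW1
  have hH : H.map Complex.ofReal = W * diagonal (fun i => (l i : ℂ)) * Wᵀ := by
    have := congrArg (fun A : Matrix V V ℝ => A.map Complex.ofRealHom) h
    simp only [Matrix.map_mul, transpose_map] at this
    rw [diagonal_map (map_zero _)] at this
    exact this
  have hs : shifted H t = W * diagonal (fun i => (l i : ℂ) - t * Complex.I) * Wᵀ := by
    have hd : diagonal (fun i => (l i : ℂ) - t * Complex.I)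
        = diagonal (fun i => (l i : ℂ)) - ((t : ℂ) * Complex.I) • (1 : Matrix V V ℂ) := by
      rw [smul_one_eq_diagonal, diagonal_sub]
    rw [hd, Matrix.mul_sub, Matrix.sub_mul, ← hH, Matrix.mul_smul, Matrix.mul_one,
      Matrix.smul_mul, hW2, shifted]
  calc shifted H t * (W * diagonal (fun i => ((l i : ℂ) - t * Complex.I)⁻¹) * Wᵀ)
      = W * (diagonal (fun i => (l i : ℂ) - t * Complex.I) * ((Wᵀ * W)
          * (diagonal (fun i => ((l i : ℂ) - t * Complex.I)⁻¹) * Wᵀ))) := by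
        rw [hs]; simp only [Matrix.mul_assoc]
    _ = 1 := by
        rw [hW1, Matrix.one_mul, ← Matrix.mul_assoc (diagonal _), diagonal_mul_diagonal]
        simp only [mul_inv_cancel₀ (sub_mul_I_ne_zero _ ht)]
        rw [diagonal_one, Matrix.one_mul, hW2]

theorem shifted_mul_resolvent {H : Matrix V V ℝ} (hH : H.IsHermitian) {t : ℝ} (ht : 0 < t) :
    shifted H t * resolvent H t = 1 := by
  obtain ⟨U, hU, h⟩ := exists_orthogonal_diagonal hH
  rw [resolvent, inv_eq_right_inv (shifted_mul_diagonalized hU h ht)]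
  exact shifted_mul_diagonalized hU h ht

theorem resolvent_mul_shifted {H : Matrix V V ℝ} (hH : H.IsHermitian) {t : ℝ} (ht : 0 < t) :
    resolvent H t * shifted H t = 1 :=
  mul_eq_one_comm.1 (shifted_mul_resolvent hH ht)

theorem trace_resolvent {H : Matrix V V ℝ} (hH : H.IsHermitian) {t : ℝ} (ht : 0 < t) :
    (resolvent H t).trace = ∑ i, ((hH.eigenvalues i : ℂ) - t * Complex.I)⁻¹ := by
  obtain ⟨U, hU, h⟩ := exists_orthogonal_diagonal hH
  have hW1 : (U.map Complex.ofReal)ᵀ * U.map Complex.ofReal = 1 := by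
    have := congrArg (fun A : Matrix V V ℝ => A.map Complex.ofRealHom) hU
    simp only [Matrix.map_mul, transpose_map] at this
    rw [Matrix.map_one _ (map_zero _) (map_one _)] at this
    exact this
  rw [resolvent, inv_eq_right_inv (shifted_mul_diagonalized hU h ht), Matrix.mul_assoc,
    trace_mul_comm, Matrix.mul_assoc, hW1, Matrix.mul_one, trace_diagonal]

theorem im_trace_resolvent {H : Matrix V V ℝ} (hH : H.IsHermitian) {t : ℝ} (ht : 0 < t) :
    (resolvent H t).trace.im = ∑ i, t / (hH.eigenvalues i ^ 2 + t ^ 2) := by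
  rw [trace_resolvent hH ht, Complex.im_sum]
  refine Finset.sum_congr rfl fun i _ => ?_
  rw [Complex.inv_im, Complex.normSq_apply]
  simp [sq]

/-- The resolvent bound: `H - i t` expands norms by at least `t`. -/
theorem sum_normSq_le_shifted {H : Matrix V V ℝ} (hH : H.IsHermitian) (t : ℝ) (x : V → ℂ) :
    t ^ 2 * ∑ k, ‖x k‖ ^ 2 ≤ ∑ k, ‖(shifted H t *ᵥ x) k‖ ^ 2 := by
  set a : V → ℝ := fun k => (x k).re
  set b : V → ℝ := fun k => (x k).im
  have hre : ∀ k, ((shifted H t *ᵥ x) k).re = (H *ᵥ a) k + t * b k := fun k => by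
    rw [shifted_mulVec_apply]; simp [mulVec, dotProduct, a, b, Complex.re_sum]
  have him : ∀ k, ((shifted H t *ᵥ x) k).im = (H *ᵥ b) k - t * a k := fun k => by
    rw [shifted_mulVec_apply]; simp [mulVec, dotProduct, a, b, Complex.im_sum]
  -- Symmetry of `H` cancels the cross terms between the real and imaginary parts of `x`.
  have hsym : ∑ k, (H *ᵥ a) k * b k = ∑ k, (H *ᵥ b) k * a k := by
    have hHt : Hᵀ = H := by
      rw [← conjTranspose_eq_transpose_of_trivial]; exact hH
    have : (H *ᵥ a) ⬝ᵥ b = (H *ᵥ b) ⬝ᵥ a := by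
      rw [dotProduct_comm, dotProduct_mulVec, ← mulVec_transpose, hHt]
    simpa only [dotProduct] using this
  have hexp : ∑ k, ‖(shifted H t *ᵥ x) k‖ ^ 2
      = ∑ k, ((H *ᵥ a) k ^ 2 + (H *ᵥ b) k ^ 2) + t ^ 2 * ∑ k, ‖x k‖ ^ 2
        + 2 * t * (∑ k, (H *ᵥ a) k * b k - ∑ k, (H *ᵥ b) k * a k) := by
    simp only [Complex.sq_norm, Complex.normSq_apply, hre, him, Finset.mul_sum,
      ← Finset.sum_sub_distrib, ← Finset.sum_add_distrib]
    exact Finset.sum_congr rfl fun k _ => by simp only [a, b]; ring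
  rw [hexp, hsym, sub_self, mul_zero, add_zero]
  exact le_add_of_nonneg_left (Finset.sum_nonneg fun k _ => by positivity)

theorem sum_normSq_resolvent_mulVec_le {H : Matrix V V ℝ} (hH : H.IsHermitian) {t : ℝ} (ht : 0 < t)
    (y : V → ℂ) : ∑ k, ‖(resolvent H t *ᵥ y) k‖ ^ 2 ≤ (∑ k, ‖y k‖ ^ 2) / t ^ 2 := by
  have h := sum_normSq_le_shifted hH t (resolvent H t *ᵥ y)
  rw [mulVec_mulVec, shifted_mul_resolvent hH ht, one_mulVec] at h
  rw [le_div_iff₀ (by positivity), mul_comm]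
  exact h

theorem sum_normSq_resolvent_col_le {H : Matrix V V ℝ} (hH : H.IsHermitian) {t : ℝ} (ht : 0 < t)
    (l : V) : ∑ k, ‖resolvent H t k l‖ ^ 2 ≤ 1 / t ^ 2 := by
  have h := sum_normSq_resolvent_mulVec_le hH ht (Pi.single l 1)
  simpa [Pi.single_apply, apply_ite] using h

theorem norm_resolvent_apply_le {H : Matrix V V ℝ} (hH : H.IsHermitian) {t : ℝ} (ht : 0 < t)
    (k l : V) : ‖resolvent H t k l‖ ≤ 1 / t := by
  rw [← sq_le_sq₀ (norm_nonneg _) (by positivity), div_pow, one_pow]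
  exact (Finset.single_le_sum (f := fun k => ‖resolvent H t k l‖ ^ 2) (fun _ _ => sq_nonneg _)
    (Finset.mem_univ k)).trans (sum_normSq_resolvent_col_le hH ht l)

/-- The matrix `H` with the row and the column of `i` replaced by zero. -/
def eraseRowCol {V : Type*} [DecidableEq V] (H : Matrix V V ℝ) (i : V) : Matrix V V ℝ :=
  Matrix.of fun k l => if k = i ∨ l = i then 0 else H k l

theorem eraseRowCol_isHermitian {V : Type*} [DecidableEq V] {H : Matrix V V ℝ} (hH : H.IsHermitian) (i : V) :
    (eraseRowCol H i).IsHermitian := by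
  ext k l
  have := hH.apply k l
  simp only [star_trivial] at this
  simp only [eraseRowCol, conjTranspose_apply, of_apply, star_trivial, this, or_comm]

/-- The Schur complement formula for a diagonal entry of the resolvent. -/
theorem resolvent_diag_eq {H : Matrix V V ℝ} (hH : H.IsHermitian) {t : ℝ} (ht : 0 < t) (i : V)
    (hi : H i i = 0) :
    t * Complex.I * resolvent H t i i + 1 = -(resolvent H t i i *
      ∑ k ∈ Finset.univ.erase i, ∑ l ∈ Finset.univ.erase i,
        H i k * H i l * resolvent (eraseRowCol H i) t k l) := by
  set G := resolvent H t with hG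
  set M := resolvent (eraseRowCol H i) t with hM
  have hH' := eraseRowCol_isHermitian hH i
  have hsym : ∀ k l, H k l = H l k := fun k l => by simpa using (hH.apply k l).symm
  set z : ℂ := t * Complex.I with hz
  have hz0 : z ≠ 0 := by simp [hz, ht.ne']
  set x : V → ℂ := fun k => G k i with hx
  have hcol : ∀ k, ∑ l, (H k l : ℂ) * x l - z * x k = if k = i then 1 else 0 := fun k => by
    have h := congrFun (congrFun (shifted_mul_resolvent hH ht) k) i
    simp only [mul_apply, shifted_apply, sub_mul, Finset.sum_sub_distrib, ite_mul, zero_mul,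
      Finset.sum_ite_eq, Finset.mem_univ, if_true, one_apply] at h
    exact h
  -- Column `i` of the resolvent solves the erased system, with the lost row and column moved to the
  -- right-hand side.
  have hK' : shifted (eraseRowCol H i) t *ᵥ x
      = (-x i) • ((fun k => (H i k : ℂ)) + Pi.single i z) := by
    ext k
    have h := hcol k
    simp only [mulVec, dotProduct, shifted_apply, sub_mul, Finset.sum_sub_distrib, ite_mul,
      zero_mul, Finset.sum_ite_eq, Finset.mem_univ, if_true, Pi.smul_apply, Pi.add_apply,
      smul_eq_mul, eraseRowCol, of_apply, Pi.single_apply]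
    by_cases hk : k = i
    · subst hk
      simp [hi, hz]; ring
    · rw [← Finset.add_sum_erase _ _ (Finset.mem_univ i)] at h ⊢
      have : ∑ l ∈ Finset.univ.erase i, ((if k = i ∨ l = i then 0 else H k l : ℝ) : ℂ) * x l
          = ∑ l ∈ Finset.univ.erase i, (H k l : ℂ) * x l :=
        Finset.sum_congr rfl fun l hl => by simp [hk, Finset.ne_of_mem_erase hl]
      rw [this]
      simp only [hk, if_false, or_true, if_true, hsym i k] at h ⊢
      push_cast
      linear_combination h
  have hxM : x = (-x i) • (M *ᵥ (fun k => (H i k : ℂ)) + M *ᵥ Pi.single i z) := by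
    have h := congrArg (fun y => M *ᵥ y) hK'
    simp only [mulVec_mulVec, mulVec_smul, mulVec_add] at h
    rw [resolvent_mul_shifted hH' ht, one_mulVec] at h
    exact h
  -- Column `i` of the erased shifted matrix is `-z` times a unit vector, so its inverse sends that
  -- vector to a multiple of itself; row `i` of `H` vanishes there because `H i i = 0`.
  have hrow : ∑ k, (H i k : ℂ) * (M *ᵥ Pi.single i z) k = 0 := by
    refine Finset.sum_eq_zero fun k _ => ?_
    by_cases hk : k = i
    · simp [hk, hi]
    · have h := congrFun (congrFun (resolvent_mul_shifted hH' ht) k) i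
      have hs : ∀ l, shifted (eraseRowCol H i) t l i = if l = i then -z else 0 := fun l => by
        rw [shifted_apply]
        split_ifs <;> simp [eraseRowCol, hz]
      have hMk : M k i = 0 := by
        simpa [Matrix.mul_apply, hs, hk, hz0] using h
      simp [mulVec, dotProduct, Pi.single_apply, hMk]
  have h1 := hcol i
  rw [if_pos rfl] at h1
  have h2 : ∑ l, (H i l : ℂ) * x l
      = -x i * ∑ k, (H i k : ℂ) * (M *ᵥ (fun k => (H i k : ℂ))) k := by
    have : ∀ l, (H i l : ℂ) * x l = -x i * ((H i l : ℂ) * (M *ᵥ (fun k => (H i k : ℂ))) l)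
        + -x i * ((H i l : ℂ) * (M *ᵥ Pi.single i z) l) := fun l => by
      conv_lhs => rw [hxM]
      simp only [Pi.smul_apply, Pi.add_apply, smul_eq_mul]
      ring
    rw [Finset.sum_congr rfl fun l _ => this l, Finset.sum_add_distrib, ← Finset.mul_sum,
      ← Finset.mul_sum, hrow, mul_zero, add_zero]
  have h3 : ∑ k, (H i k : ℂ) * (M *ᵥ (fun k => (H i k : ℂ))) k
      = ∑ k ∈ Finset.univ.erase i, ∑ l ∈ Finset.univ.erase i, H i k * H i l * M k l := by
    rw [← Finset.add_sum_erase _ _ (Finset.mem_univ i), hi, Complex.ofReal_zero, zero_mul,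
      zero_add]
    refine Finset.sum_congr rfl fun k _ => ?_
    rw [mulVec, dotProduct, Finset.mul_sum, ← Finset.add_sum_erase _ _ (Finset.mem_univ i), hi,
      Complex.ofReal_zero, mul_zero, mul_zero, zero_add]
    exact Finset.sum_congr rfl fun l _ => by ring
  rw [h2, h3] at h1
  change z * x i + 1 = -(x i * _)
  linear_combination -h1

theorem norm_sum_mul_le_of_sq_le {ι : Type*} (s : Finset ι) (f g : ι → ℂ) {a b : ℝ} (ha : 0 ≤ a)
    (hb : 0 ≤ b) (hf : ∑ k ∈ s, ‖f k‖ ^ 2 ≤ a ^ 2) (hg : ∑ k ∈ s, ‖g k‖ ^ 2 ≤ b ^ 2) :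
    ‖∑ k ∈ s, f k * g k‖ ≤ a * b := by
  refine (norm_sum_le _ _).trans ?_
  simp only [norm_mul]
  exact (le_abs_self _).trans (abs_sum_mul_le_of_sq_le s _ _ ha hb hf hg)

/-- Erasing one row and column has a bounded effect on the trace of the resolvent. -/
theorem norm_trace_resolvent_sub_le {H : Matrix V V ℝ} (hH : H.IsHermitian) {t : ℝ} (ht : 0 < t)
    (i : V) (hi : H i i = 0) (hrow : ∑ k, H i k ^ 2 ≤ 1) :
    ‖(resolvent H t).trace - (resolvent (eraseRowCol H i) t).trace‖ ≤ 2 / t ^ 2 := by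
  set G := resolvent H t with hG
  set M := resolvent (eraseRowCol H i) t with hM
  have hH' := eraseRowCol_isHermitian hH i
  have hsym : ∀ k l, H k l = H l k := fun k l => by simpa using (hH.apply k l).symm
  -- The resolvent identity. The perturbation lives on row and column `i`, so after cyclic rotation
  -- the trace consists of two pairings of `M * G` with that row, each at most `1 / t ^ 2`.
  have hdiff : G - M = -(G * ((shifted H t - shifted (eraseRowCol H i) t) * M)) := by
    rw [Matrix.sub_mul, Matrix.mul_sub, shifted_mul_resolvent hH' ht, ← Matrix.mul_assoc,
      resolvent_mul_shifted hH ht, Matrix.one_mul, Matrix.mul_one]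
    abel
  have hV : ∀ k l, (shifted H t - shifted (eraseRowCol H i) t) k l
      = (if k = i then (H i l : ℂ) else 0) + if l = i then (H i k : ℂ) else 0 := fun k l => by
    simp only [Matrix.sub_apply, shifted_apply, eraseRowCol, of_apply]
    by_cases hk : k = i <;> by_cases hl : l = i
    · subst hk; subst hl; simp [hi]
    · subst hk; simp [hl]
    · subst hl; simp [hk, hsym l k]
    · simp [hk, hl]
  have htr : G.trace - M.trace = -(∑ l, (H i l : ℂ) * (M * G) l i
      + ∑ k, (M * G) i k * (H i k : ℂ)) := by
    rw [← trace_sub, hdiff, trace_neg, trace_mul_comm, Matrix.mul_assoc]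
    congr 1
    change ∑ k, ∑ l, (shifted H t - shifted (eraseRowCol H i) t) k l * (M * G) l k = _
    simp only [hV, add_mul, ite_mul, zero_mul, Finset.sum_add_distrib]
    congr 1
    · rw [Finset.sum_comm]
      simp
    · simp [mul_comm]
  have hMG : ∀ y : V → ℂ,
      ∑ k, ‖((M * G) *ᵥ y) k‖ ^ 2 ≤ (∑ k, ‖y k‖ ^ 2) / t ^ 2 / t ^ 2 := fun y => by
    rw [← mulVec_mulVec]
    refine (sum_normSq_resolvent_mulVec_le hH' ht _).trans ?_
    exact div_le_div_of_nonneg_right (sum_normSq_resolvent_mulVec_le hH ht y) (by positivity)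
  have hrow' : ∑ k, ‖(H i k : ℂ)‖ ^ 2 ≤ 1 ^ 2 := by
    simpa [Complex.norm_real, sq_abs] using hrow
  have hb1 : ‖∑ l, (H i l : ℂ) * (M * G) l i‖ ≤ 1 * (1 / t ^ 2) := by
    refine norm_sum_mul_le_of_sq_le _ _ _ zero_le_one (by positivity) hrow' ?_
    have h := hMG (Pi.single i 1)
    have e : ∑ k, ‖(Pi.single i 1 : V → ℂ) k‖ ^ 2 = 1 := by simp [Pi.single_apply, apply_ite]
    rw [e] at h
    simp only [mulVec_single, MulOpposite.op_one, one_smul, col_apply] at h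
    refine h.trans (le_of_eq ?_)
    field_simp
  have hb2 : ‖∑ k, (M * G) i k * (H i k : ℂ)‖ ≤ 1 / t ^ 2 := by
    have h := hMG (fun k => (H i k : ℂ))
    rw [← sq_le_sq₀ (norm_nonneg _) (by positivity)]
    refine (Finset.single_le_sum (f := fun j => ‖((M * G) *ᵥ fun k => (H i k : ℂ)) j‖ ^ 2)
      (fun _ _ => sq_nonneg _) (Finset.mem_univ i)).trans (h.trans ?_)
    rw [div_div, div_pow, one_pow, ← sq]
    exact div_le_div_of_nonneg_right (by simpa using hrow') (by positivity)
  rw [htr, norm_neg]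
  refine (norm_add_le _ _).trans ((add_le_add hb1 hb2).trans (le_of_eq ?_))
  ring

end Resolvent
end WeightedDistance

namespace WeightedDistance

open Matrix SimpleGraph unitInterval

/-! ### The approximate self-consistent equation -/

section Wigner

variable {V : Type*} [Fintype V]

/-- The normalised centred adjacency matrix. -/
noncomputable def wigner (p : ℝ) (Γ : SimpleGraph V) : Matrix V V ℝ :=
  (√(Fintype.card V))⁻¹ • centered p Γ

theorem wigner_apply (p : ℝ) (Γ : SimpleGraph V) (i j : V) :
    wigner p Γ i j = (√(Fintype.card V))⁻¹ * centered p Γ i j := rfl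

theorem wigner_isHermitian (p : ℝ) (Γ : SimpleGraph V) : (wigner p Γ).IsHermitian := by
  ext i j
  rw [conjTranspose_apply, star_trivial, wigner_apply, wigner_apply, centered_comm]

theorem sum_wigner_row_sq_le (p : I) (Γ : SimpleGraph V) (i : V) :
    ∑ k, wigner (p : ℝ) Γ i k ^ 2 ≤ 1 := by
  have hn : (0 : ℝ) < Fintype.card V := by exact_mod_cast Fintype.card_pos_iff.2 ⟨i⟩
  calc ∑ k, wigner (p : ℝ) Γ i k ^ 2 ≤ ∑ _k : V, (Fintype.card V : ℝ)⁻¹ :=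
        Finset.sum_le_sum fun k _ => by
          rw [wigner_apply, mul_pow, inv_pow, Real.sq_sqrt hn.le]
          exact mul_le_of_le_one_right (inv_nonneg.2 hn.le)
            ((sq_le_one_iff_abs_le_one _).2 (abs_centered_le Γ p i k))
    _ = 1 := by
      rw [Finset.sum_const, Finset.card_univ, nsmul_eq_mul, mul_inv_cancel₀ hn.ne']

variable [DecidableEq V]

/-- The independence behind the Schur complement argument: the resolvent of the erased matrix gives
admissible coefficients in `expect_quadratic_sq_le`. -/
theorem ignoresEdge_eraseRowCol_wigner (p : ℝ) (i m : V) :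
    IgnoresEdge i m (fun Γ => eraseRowCol (wigner p Γ) i) := fun Γ _ => by
  ext k l
  simp only [eraseRowCol, of_apply]
  split_ifs with h
  · rfl
  · rw [not_or] at h
    rw [wigner_apply, wigner_apply, centered_sup_edge]
    intro h'
    rcases Sym2.eq_iff.1 h' with ⟨h1, -⟩ | ⟨h1, -⟩
    · exact h.1 h1.symm
    · exact h.2 h1.symm

/-- Mean absolute deviation of the quadratic form of the resolvent in an independent row. -/
theorem expect_abs_quadratic_le (p : I) {t : ℝ} (ht : 0 < t) (i : V) (f : ℂ → ℝ)
    (hf : ∀ z, |f z| ≤ ‖z‖) :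
    expect p (fun Γ : SimpleGraph V =>
        |∑ k ∈ Finset.univ.erase i, ∑ l ∈ Finset.univ.erase i,
            centered p Γ i k * centered p Γ i l *
              f (resolvent (eraseRowCol (wigner p Γ) i) t k l)
          - p * (1 - p) * ∑ k ∈ Finset.univ.erase i,
              f (resolvent (eraseRowCol (wigner p Γ) i) t k k)|)
      ≤ √(Fintype.card V) * (1 + 4 / t ^ 2) / 2 := by
  have hn : (0 : ℝ) < Fintype.card V := by exact_mod_cast Fintype.card_pos_iff.2 ⟨i⟩
  refine (expect_abs_le p (Real.sqrt_pos.2 hn) _).trans ?_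
  have h := expect_quadratic_sq_le p i (Finset.univ.erase i) (by simp)
    (fun k l Γ => f (resolvent (eraseRowCol (wigner p Γ) i) t k l))
    (fun m k l _ Γ hΓ => by simp only [ignoresEdge_eraseRowCol_wigner (p : ℝ) i m Γ hΓ])
  -- The squared Frobenius norm of the resolvent is at most `n / t²`, by its column bound.
  have hM : ∑ k ∈ Finset.univ.erase i, ∑ l ∈ Finset.univ.erase i, expect p
      (fun Γ => f (resolvent (eraseRowCol (wigner (p : ℝ) Γ) i) t k l) ^ 2)
      ≤ Fintype.card V * (1 / t ^ 2) := by
    rw [Finset.sum_comm]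
    calc _ ≤ ∑ _l ∈ Finset.univ.erase i, 1 / t ^ 2 := Finset.sum_le_sum fun l _ => by
          rw [← expect_sum, ← expect_const (V := V) p (1 / t ^ 2)]
          refine expect_mono p fun Γ => le_trans ?_ (sum_normSq_resolvent_col_le
            (eraseRowCol_isHermitian (wigner_isHermitian (p : ℝ) Γ) i) ht l)
          refine (Finset.sum_le_sum fun k _ => ?_).trans (Finset.sum_le_univ_sum_of_nonneg
            (f := fun k => ‖resolvent (eraseRowCol (wigner (p : ℝ) Γ) i) t k l‖ ^ 2)
            fun _ => sq_nonneg _)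
          rw [← sq_abs]
          exact pow_le_pow_left₀ (abs_nonneg _) (hf _) 2
      _ ≤ Fintype.card V * (1 / t ^ 2) := by
          rw [Finset.sum_const, nsmul_eq_mul]
          refine mul_le_mul_of_nonneg_right ?_ (by positivity)
          exact_mod_cast Finset.card_le_univ _
  have h' := h.trans (mul_le_mul_of_nonneg_left hM zero_le_four)
  refine div_le_div_of_nonneg_right ?_ zero_le_two
  rw [mul_add, mul_one]
  refine add_le_add_right ?_ _
  rw [div_le_iff₀ (Real.sqrt_pos.2 hn)]
  refine h'.trans (le_of_eq ?_)
  rw [mul_right_comm, Real.mul_self_sqrt hn.le]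
  ring

/-- The normalised trace of the resolvent, i.e. the Stieltjes transform of the empirical spectral
distribution, at `i t`. -/
noncomputable def stieltjes (p : ℝ) (t : ℝ) (Γ : SimpleGraph V) : ℂ :=
  (resolvent (wigner p Γ) t).trace / Fintype.card V

/-- Averaging the Schur formula over `i` turns the left side into the mean of `G i i * (v * s - q
i)`, where `G i i` is at most `1 / t`. The error in `q i` comes from the fluctuation of the
quadratic form, the missing diagonal entry (`1 / t`) and the erased row (`2 / t ^ 2`). -/
theorem norm_selfConsistent_le (p : I) {t : ℝ} (ht : 0 < t) [Nonempty V] (Γ : SimpleGraph V) :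
    ‖1 + t * Complex.I * stieltjes p t Γ + (p * (1 - p) : ℝ) * stieltjes p t Γ ^ 2‖
      ≤ (1 / t) * ((Fintype.card V : ℝ)⁻¹ * ∑ i,
        ((Fintype.card V : ℝ)⁻¹ * (
          |∑ k ∈ Finset.univ.erase i, ∑ l ∈ Finset.univ.erase i,
            centered p Γ i k * centered p Γ i l *
              (resolvent (eraseRowCol (wigner p Γ) i) t k l).re
          - p * (1 - p) * ∑ k ∈ Finset.univ.erase i,
              (resolvent (eraseRowCol (wigner p Γ) i) t k k).re|
          + |∑ k ∈ Finset.univ.erase i, ∑ l ∈ Finset.univ.erase i,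
            centered p Γ i k * centered p Γ i l *
              (resolvent (eraseRowCol (wigner p Γ) i) t k l).im
          - p * (1 - p) * ∑ k ∈ Finset.univ.erase i,
              (resolvent (eraseRowCol (wigner p Γ) i) t k k).im|
          + (1 / t + 2 / t ^ 2)))) := by
  have hp0 := p.2.1
  have hp1 := p.2.2
  set v : ℝ := p * (1 - p) with hv
  have hv0 : 0 ≤ v := mul_nonneg hp0 (by linarith)
  have hv1 : v ≤ 1 := by nlinarith
  have hn : (0 : ℝ) < Fintype.card V := by exact_mod_cast Fintype.card_pos
  set n : ℝ := ((Fintype.card V : ℕ) : ℝ) with hn_def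
  have hnC : (n : ℂ) ≠ 0 := by exact_mod_cast hn.ne'
  have hW := wigner_isHermitian (p : ℝ) Γ
  have hWd : ∀ i, wigner (p : ℝ) Γ i i = 0 := fun i => by rw [wigner_apply]; simp
  set H := wigner (p : ℝ) Γ with hH
  set G := resolvent H t with hG
  set s : ℂ := stieltjes p t Γ with hs
  have hsG : n * s = ∑ i, G i i := by
    rw [hs, stieltjes, ← hH, ← hG, hn_def]
    push_cast
    rw [mul_div_cancel₀]
    · rfl
    · exact_mod_cast Fintype.card_ne_zero
  set q : V → ℂ := fun i => ∑ k ∈ Finset.univ.erase i, ∑ l ∈ Finset.univ.erase i,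
        H i k * H i l * resolvent (eraseRowCol H i) t k l with hq
  have hmain : 1 + t * Complex.I * s + (v : ℂ) * s ^ 2
      = (n : ℂ)⁻¹ * ∑ i, G i i * (v * s - q i) := by
    have h1 : ∑ i, G i i * q i = -∑ i, (t * Complex.I * G i i + 1) := by
      rw [← Finset.sum_neg_distrib]
      refine Finset.sum_congr rfl fun i _ => ?_
      rw [hG, resolvent_diag_eq hW ht i (hWd i), neg_neg]
    have h2 : ∑ i : V, (1 : ℂ) = n := by
      rw [hn_def]; simp
    rw [eq_inv_mul_iff_mul_eq₀ hnC]
    simp only [mul_sub, Finset.sum_sub_distrib, h1, ← Finset.sum_mul, ← hsG,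
      Finset.sum_add_distrib, ← Finset.mul_sum, h2]
    ring
  have hterm : ∀ i, ‖v * s - q i‖ ≤ n⁻¹ * (
          |∑ k ∈ Finset.univ.erase i, ∑ l ∈ Finset.univ.erase i,
            centered p Γ i k * centered p Γ i l * (resolvent (eraseRowCol H i) t k l).re
          - v * ∑ k ∈ Finset.univ.erase i, (resolvent (eraseRowCol H i) t k k).re|
          + |∑ k ∈ Finset.univ.erase i, ∑ l ∈ Finset.univ.erase i,
            centered p Γ i k * centered p Γ i l * (resolvent (eraseRowCol H i) t k l).im
          - v * ∑ k ∈ Finset.univ.erase i, (resolvent (eraseRowCol H i) t k k).im|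
          + (1 / t + 2 / t ^ 2)) := fun i => by
    set M := resolvent (eraseRowCol H i) t with hM
    set E : ℂ := ∑ k ∈ Finset.univ.erase i, ∑ l ∈ Finset.univ.erase i,
            centered p Γ i k * centered p Γ i l * M k l
          - v * ∑ k ∈ Finset.univ.erase i, M k k with hE
    have hEre : E.re = ∑ k ∈ Finset.univ.erase i, ∑ l ∈ Finset.univ.erase i,
            centered p Γ i k * centered p Γ i l * (M k l).re
          - v * ∑ k ∈ Finset.univ.erase i, (M k k).re := by
      simp only [hE, Complex.sub_re, Complex.re_sum, ← Complex.ofReal_mul, Complex.re_ofReal_mul]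
    have hEim : E.im = ∑ k ∈ Finset.univ.erase i, ∑ l ∈ Finset.univ.erase i,
            centered p Γ i k * centered p Γ i l * (M k l).im
          - v * ∑ k ∈ Finset.univ.erase i, (M k k).im := by
      simp only [hE, Complex.sub_im, Complex.im_sum, ← Complex.ofReal_mul, Complex.im_ofReal_mul]
    have hqE : n * q i = E + v * ∑ k ∈ Finset.univ.erase i, M k k := by
      rw [hE, sub_add_cancel, hq]
      simp only [Finset.mul_sum]
      refine Finset.sum_congr rfl fun k _ => Finset.sum_congr rfl fun l _ => ?_
      have hsq : (n : ℂ) * (((√n)⁻¹ : ℝ) : ℂ) * (((√n)⁻¹ : ℝ) : ℂ) = 1 := by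
        rw [← Complex.ofReal_mul, ← Complex.ofReal_mul, mul_assoc, ← mul_inv,
          Real.mul_self_sqrt hn.le, mul_inv_cancel₀ hn.ne', Complex.ofReal_one]
      rw [hH, wigner_apply, wigner_apply, ← hn_def, Complex.ofReal_mul, Complex.ofReal_mul]
      linear_combination (centered p Γ i k * centered p Γ i l * M k l : ℂ) * hsq
    have hsplit : n * (v * s - q i) = v * (G.trace - M.trace) + v * M i i - E := by
      have h1 : M.trace = M i i + ∑ k ∈ Finset.univ.erase i, M k k :=
        (Finset.add_sum_erase _ _ (Finset.mem_univ i)).symm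
      have h2 : G.trace = n * s := hsG.symm
      rw [h1, h2]
      linear_combination -hqE
    have hb1 := norm_trace_resolvent_sub_le hW ht i (hWd i) (sum_wigner_row_sq_le p Γ i)
    have hb2 := norm_resolvent_apply_le (eraseRowCol_isHermitian hW i) ht i i
    have hb3 : ‖n * (v * s - q i)‖ ≤ 2 / t ^ 2 + 1 / t + (|E.re| + |E.im|) := by
      rw [hsplit]
      refine (norm_sub_le _ _).trans (add_le_add ((norm_add_le _ _).trans (add_le_add ?_ ?_))
        (Complex.norm_le_abs_re_add_abs_im E))
      · rw [norm_mul, Complex.norm_real, Real.norm_of_nonneg hv0]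
        exact (mul_le_of_le_one_left (norm_nonneg _) hv1).trans hb1
      · rw [norm_mul, Complex.norm_real, Real.norm_of_nonneg hv0]
        exact (mul_le_of_le_one_left (norm_nonneg _) hv1).trans hb2
    rw [norm_mul, Complex.norm_real, Real.norm_of_nonneg hn.le] at hb3
    rw [← hEre, ← hEim, inv_mul_eq_div, le_div_iff₀ hn, mul_comm]
    linarith
  rw [hmain, norm_mul, norm_inv, Complex.norm_real, Real.norm_of_nonneg hn.le, mul_left_comm]
  refine mul_le_mul_of_nonneg_left ?_ (inv_nonneg.2 hn.le)
  rw [Finset.mul_sum]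
  refine (norm_sum_le _ _).trans (Finset.sum_le_sum fun i _ => ?_)
  rw [norm_mul]
  exact mul_le_mul (norm_resolvent_apply_le hW ht i i) (hterm i) (norm_nonneg _) (by positivity)

/-- The self-consistent equation of the semicircle law holds approximately in mean. -/
theorem expect_selfConsistent_le (p : I) {t : ℝ} (ht : 0 < t) [Nonempty V] :
    expect p (fun Γ : SimpleGraph V =>
      ‖1 + t * Complex.I * stieltjes p t Γ + (p * (1 - p) : ℝ) * stieltjes p t Γ ^ 2‖)
      ≤ (1 / t) * ((1 + 4 / t ^ 2) * (√(Fintype.card V))⁻¹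
        + (1 / t + 2 / t ^ 2) * (Fintype.card V : ℝ)⁻¹) := by
  have hn : (0 : ℝ) < Fintype.card V := by exact_mod_cast Fintype.card_pos
  refine (expect_mono p (norm_selfConsistent_le p ht)).trans ?_
  simp only [expect_const_mul, expect_sum, expect_add, expect_const]
  refine mul_le_mul_of_nonneg_left ?_ (by positivity)
  rw [inv_mul_eq_div, div_le_iff₀ hn]
  calc _ ≤ ∑ _i : V, (Fintype.card V : ℝ)⁻¹ * (√(Fintype.card V) * (1 + 4 / t ^ 2) / 2
        + √(Fintype.card V) * (1 + 4 / t ^ 2) / 2 + (1 / t + 2 / t ^ 2)) :=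
        Finset.sum_le_sum fun i _ => mul_le_mul_of_nonneg_left (add_le_add_left (add_le_add
          (expect_abs_quadratic_le p ht i Complex.re Complex.abs_re_le_norm)
          (expect_abs_quadratic_le p ht i Complex.im Complex.abs_im_le_norm)) _)
          (inv_nonneg.2 hn.le)
    _ = _ := by
      have h1 : (√(Fintype.card V))⁻¹ = √(Fintype.card V) * (Fintype.card V : ℝ)⁻¹ := by
        rw [inv_eq_iff_eq_inv, mul_inv, inv_inv]
        nth_rewrite 3 [← Real.mul_self_sqrt hn.le]
        rw [inv_mul_cancel_left₀ (Real.sqrt_pos.2 hn).ne']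
      rw [Finset.sum_const, Finset.card_univ, nsmul_eq_mul, h1]
      ring

/-- Stability of the self-consistent equation of the semicircle law on the imaginary axis. -/
theorem abs_im_sub_le {t v : ℝ} (ht : 0 < t) (hv : 0 < v) {s : ℂ} (hs : 0 ≤ s.im) :
    |s.im - (√(t ^ 2 + 4 * v) - t) / (2 * v)| ≤
      ‖1 + t * Complex.I * s + (v : ℝ) * s ^ 2‖ / t := by
  set r := √(t ^ 2 + 4 * v) with hr
  have hr2 : r ^ 2 = t ^ 2 + 4 * v := Real.sq_sqrt (by positivity)
  have hr0 : 0 ≤ r := Real.sqrt_nonneg _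
  set g : ℝ := (r - t) / (2 * v) with hg
  set g' : ℝ := (r + t) / (2 * v) with hg'
  have h1 : v * (g' - g) = t := by rw [hg, hg']; field_simp; ring
  have h2 : v * (g * g') = 1 := by rw [hg, hg']; field_simp; nlinarith
  -- The roots are `g * I` and `-g' * I`. As `s.im ≥ 0`, the distance of `s` to the second is at
  -- least `g' ≥ g' - g = t / v`.
  have hfac : 1 + t * Complex.I * s + (v : ℝ) * s ^ 2
      = v * ((s - g * Complex.I) * (s + g' * Complex.I)) := by
    have h1' : (v : ℂ) * (g' - g) = t := by exact_mod_cast h1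
    have h2' : (v : ℂ) * (g * g') = 1 := by exact_mod_cast h2
    linear_combination (-Complex.I * s) * h1' - h2' + (v * g * g') * Complex.I_mul_I
  have hb1 : |s.im - g| ≤ ‖s - g * Complex.I‖ := by
    simpa using Complex.abs_im_le_norm (s - g * Complex.I)
  have hb2 : t / v ≤ ‖s + g' * Complex.I‖ := by
    have h3 : s.im + g' ≤ ‖s + g' * Complex.I‖ := by
      simpa using (le_abs_self _).trans (Complex.abs_im_le_norm (s + g' * Complex.I))
    have h4 : 0 ≤ g := by
      rw [hg]
      refine div_nonneg (sub_nonneg.2 ?_) (by positivity)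
      exact Real.le_sqrt_of_sq_le (by linarith)
    have h5 : t / v = g' - g := by rw [← h1]; field_simp
    linarith
  rw [le_div_iff₀ ht, hfac, norm_mul, norm_mul, Complex.norm_real, Real.norm_of_nonneg hv.le]
  calc |s.im - g| * t = v * (|s.im - g| * (t / v)) := by field_simp
    _ ≤ _ := mul_le_mul_of_nonneg_left (mul_le_mul hb1 hb2 (by positivity) (norm_nonneg _)) hv.le

end Wigner

end WeightedDistance

namespace WeightedDistance

open Matrix SimpleGraph unitInterval MeasureTheory Set Filter Topology

/-! ### Coulson integrals of a number and of the semicircle law -/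

section Coulson

theorem hasDerivAt_mul_arctan {x : ℝ} (hx : x ≠ 0) (t : ℝ) :
    HasDerivAt (fun t => x * Real.arctan (t / x)) (x ^ 2 / (x ^ 2 + t ^ 2)) t := by
  have h := ((hasDerivAt_id t).div_const x).arctan.const_mul x
  refine h.congr_deriv ?_
  simp only [id]
  field_simp

theorem tendsto_mul_arctan {x : ℝ} (hx : 0 < x) :
    Tendsto (fun t => x * Real.arctan (t / x)) atTop (𝓝 (x * (Real.pi / 2))) :=
  (((Real.tendsto_arctan_atTop.mono_right nhdsWithin_le_nhds).comp
    (tendsto_id.atTop_div_const hx))).const_mul x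

theorem integrableOn_sq_div (x : ℝ) :
    IntegrableOn (fun t : ℝ => x ^ 2 / (x ^ 2 + t ^ 2)) (Ioi 0) := by
  rcases eq_or_ne x 0 with rfl | hx
  · simp
  · have hx' : 0 < |x| := abs_pos.2 hx
    have := integrableOn_Ioi_deriv_of_nonneg (a := 0)
      (hasDerivAt_mul_arctan hx'.ne' 0).continuousAt.continuousWithinAt
      (fun t _ => hasDerivAt_mul_arctan hx'.ne' t) (fun t _ => by positivity)
      (tendsto_mul_arctan hx')
    simpa only [sq_abs] using this

/-- Coulson's integral representation of the absolute value. -/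
theorem integral_sq_div (x : ℝ) :
    ∫ t in Ioi (0 : ℝ), x ^ 2 / (x ^ 2 + t ^ 2) = |x| * (Real.pi / 2) := by
  rcases eq_or_ne x 0 with rfl | hx
  · simp
  · have hx' : 0 < |x| := abs_pos.2 hx
    have h := integral_Ioi_of_hasDerivAt_of_tendsto (a := 0)
      (hasDerivAt_mul_arctan hx'.ne' 0).continuousAt.continuousWithinAt
      (fun t _ => hasDerivAt_mul_arctan hx'.ne' t)
      (by simpa only [sq_abs] using integrableOn_sq_div x)
      (tendsto_mul_arctan hx')
    simpa only [sq_abs, zero_div, Real.arctan_zero, mul_zero, sub_zero] using h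

/-- The Coulson integrand of the semicircle law of variance `v`. -/
noncomputable def semicircleIntegrand (v t : ℝ) : ℝ := (√(t ^ 2 + 4 * v) - t) ^ 2 / (4 * v)

variable {v : ℝ} (hv : 0 < v)
include hv

/-- With `u = √(t² + 4v) - t` one has `t = 2v/u - u/2`, so `u²/(4v) dt = -(1/2 + u²/(8v)) du`, which
integrates to this primitive. -/
theorem hasDerivAt_semicircle (t : ℝ) :
    HasDerivAt (fun t => -((√(t ^ 2 + 4 * v) - t) / 2 + (√(t ^ 2 + 4 * v) - t) ^ 3 / (24 * v)))
      (semicircleIntegrand v t) t := by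
  have hpos : 0 < t ^ 2 + 4 * v := by positivity
  have h1 : HasDerivAt (fun t => t ^ 2 + 4 * v) (2 * t) t := by
    simpa using (hasDerivAt_pow 2 t).add_const (4 * v)
  have h2 := (h1.sqrt hpos.ne').sub (hasDerivAt_id t)
  have h3 := ((h2.div_const 2).add ((h2.pow 3).div_const (24 * v))).neg
  refine h3.congr_deriv ?_
  simp only [semicircleIntegrand, Pi.sub_apply, id]
  set r := √(t ^ 2 + 4 * v) with hr
  have hr0 : 0 < r := Real.sqrt_pos.2 hpos
  have hr2 : r ^ 2 = t ^ 2 + 4 * v := Real.sq_sqrt hpos.le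
  field_simp
  push_cast
  linear_combination -(r - t) * 24 * hr2

theorem tendsto_semicircle :
    Tendsto (fun t => -((√(t ^ 2 + 4 * v) - t) / 2 + (√(t ^ 2 + 4 * v) - t) ^ 3 / (24 * v)))
      atTop (𝓝 0) := by
  have h0 : Tendsto (fun t : ℝ => √(t ^ 2 + 4 * v) - t) atTop (𝓝 0) := by
    have hlim : Tendsto (fun t : ℝ => 4 * v / t) atTop (𝓝 0) :=
      tendsto_const_nhds.div_atTop tendsto_id
    refine tendsto_of_tendsto_of_tendsto_of_le_of_le' tendsto_const_nhds hlim ?_ ?_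
    · exact Eventually.of_forall fun t => sub_nonneg.2 (Real.le_sqrt_of_sq_le (by linarith))
    · filter_upwards [eventually_gt_atTop 0] with t ht
      have h : √(t ^ 2 + 4 * v) ≤ t + 4 * v / t := by
        rw [Real.sqrt_le_left (by positivity)]
        have : (t + 4 * v / t) ^ 2 = t ^ 2 + 8 * v + (4 * v / t) ^ 2 := by field_simp; ring
        rw [this]
        nlinarith [sq_nonneg (4 * v / t)]
      linarith
  have h := ((h0.div_const 2).add ((h0.pow 3).div_const (24 * v))).neg
  simpa using h

theorem semicircleIntegrand_nonneg (t : ℝ) : 0 ≤ semicircleIntegrand v t := by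
  rw [semicircleIntegrand]; positivity

theorem integrableOn_semicircleIntegrand : IntegrableOn (semicircleIntegrand v) (Ioi 0) :=
  integrableOn_Ioi_deriv_of_nonneg (a := 0)
    (hasDerivAt_semicircle hv 0).continuousAt.continuousWithinAt
    (fun t _ => hasDerivAt_semicircle hv t) (fun t _ => semicircleIntegrand_nonneg hv t)
    (tendsto_semicircle hv)

theorem integral_semicircleIntegrand :
    ∫ t in Ioi (0 : ℝ), semicircleIntegrand v t = 4 / 3 * √v := by
  rw [integral_Ioi_of_hasDerivAt_of_tendsto (a := 0)
    (hasDerivAt_semicircle hv 0).continuousAt.continuousWithinAt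
    (fun t _ => hasDerivAt_semicircle hv t) (integrableOn_semicircleIntegrand hv)
    (tendsto_semicircle hv)]
  have h4 : √(0 ^ 2 + 4 * v) = 2 * √v := by
    rw [show (0 : ℝ) ^ 2 + 4 * v = 2 ^ 2 * v by ring, Real.sqrt_mul (by positivity),
      Real.sqrt_sq (by positivity)]
  rw [h4]
  have hs : √v ^ 2 = v := Real.sq_sqrt hv.le
  field_simp
  linear_combination (48 * √v) * hs

theorem semicircleIntegrand_eq (t : ℝ) :
    semicircleIntegrand v t = 1 - t * ((√(t ^ 2 + 4 * v) - t) / (2 * v)) := by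
  have hr2 : √(t ^ 2 + 4 * v) ^ 2 = t ^ 2 + 4 * v := Real.sq_sqrt (by positivity)
  rw [semicircleIntegrand]
  field_simp
  linear_combination 2 * hr2

end Coulson

/-! ### Coulson integrand of a spectrum -/

section Energy

variable {V : Type*} [Fintype V] [DecidableEq V]

/-- The Coulson integrand of the empirical spectral distribution of a symmetric matrix. -/
noncomputable def coulsonIntegrand {H : Matrix V V ℝ} (hH : H.IsHermitian) (t : ℝ) : ℝ :=
  (Fintype.card V : ℝ)⁻¹ * ∑ i, hH.eigenvalues i ^ 2 / (hH.eigenvalues i ^ 2 + t ^ 2)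

theorem coulsonIntegrand_nonneg {H : Matrix V V ℝ} (hH : H.IsHermitian) (t : ℝ) :
    0 ≤ coulsonIntegrand hH t := by
  rw [coulsonIntegrand]; positivity

theorem integrableOn_coulsonIntegrand {H : Matrix V V ℝ} (hH : H.IsHermitian) :
    IntegrableOn (coulsonIntegrand hH) (Ioi 0) :=
  (integrable_finsetSum _ fun i _ => integrableOn_sq_div (hH.eigenvalues i)).const_mul _

theorem integral_coulsonIntegrand {H : Matrix V V ℝ} (hH : H.IsHermitian) :
    ∫ t in Ioi (0 : ℝ), coulsonIntegrand hH t
      = energy H hH / Fintype.card V * (Real.pi / 2) := by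
  simp only [coulsonIntegrand]
  rw [integral_const_mul, integral_finsetSum _ fun i _ => integrableOn_sq_div (hH.eigenvalues i)]
  simp only [integral_sq_div, ← Finset.sum_mul, energy]
  ring

theorem coulsonIntegrand_eq [Nonempty V] {H : Matrix V V ℝ} (hH : H.IsHermitian) {t : ℝ}
    (ht : 0 < t) :
    coulsonIntegrand hH t = 1 - t * ((resolvent H t).trace / Fintype.card V).im := by
  have hn : (Fintype.card V : ℝ) ≠ 0 := by exact_mod_cast Fintype.card_ne_zero
  rw [Complex.div_natCast_im, im_trace_resolvent hH ht, coulsonIntegrand]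
  have : ∀ i, hH.eigenvalues i ^ 2 / (hH.eigenvalues i ^ 2 + t ^ 2)
      = 1 - t * (t / (hH.eigenvalues i ^ 2 + t ^ 2)) := fun i => by
    have : hH.eigenvalues i ^ 2 + t ^ 2 ≠ 0 := by positivity
    field_simp
    ring
  simp only [this, Finset.sum_sub_distrib, ← Finset.mul_sum, Finset.sum_const, Finset.card_univ,
    nsmul_eq_mul, mul_one]
  field_simp

theorem sum_eigenvalues_sq {H : Matrix V V ℝ} (hH : H.IsHermitian) :
    ∑ i, hH.eigenvalues i ^ 2 = ∑ i, ∑ j, H i j ^ 2 := by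
  obtain ⟨U, hU, h⟩ := exists_orthogonal_diagonal hH
  have h1 : (H * H).trace = ∑ i, hH.eigenvalues i ^ 2 := by
    calc (H * H).trace = (U * (diagonal hH.eigenvalues * ((Uᵀ * U)
            * (diagonal hH.eigenvalues * Uᵀ)))).trace := by
          conv_lhs => rw [h]
          simp only [Matrix.mul_assoc]
      _ = _ := by
          rw [hU, Matrix.one_mul, trace_mul_comm, Matrix.mul_assoc, Matrix.mul_assoc, hU,
            Matrix.mul_one, diagonal_mul_diagonal, trace_diagonal]
          simp only [sq]
  rw [← h1, trace]
  refine Finset.sum_congr rfl fun i _ => ?_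
  rw [diag_apply, Matrix.mul_apply]
  refine Finset.sum_congr rfl fun j _ => ?_
  have := hH.apply i j
  rw [star_trivial] at this
  rw [this, sq]

/-- The dominating function, uniform in the size of the matrix: `x²/(x² + t²) ≤ (1 + x²)/(1 + t²)`,
and the row bounds make the mean squared eigenvalue at most `1`. -/
theorem coulsonIntegrand_le {H : Matrix V V ℝ} (hH : H.IsHermitian)
    (hrow : ∀ i, ∑ j, H i j ^ 2 ≤ 1) (t : ℝ) : coulsonIntegrand hH t ≤ 2 * (1 + t ^ 2)⁻¹ := by
  rcases isEmpty_or_nonempty V with hV | hV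
  · simp only [coulsonIntegrand, Finset.univ_eq_empty, Finset.sum_empty, mul_zero]
    positivity
  have hn : (0 : ℝ) < Fintype.card V := by exact_mod_cast Fintype.card_pos
  have hpt : ∀ x : ℝ, x ^ 2 / (x ^ 2 + t ^ 2) ≤ (1 + t ^ 2)⁻¹ * (1 + x ^ 2) := fun x => by
    rw [inv_mul_eq_div]
    rcases eq_or_ne (x ^ 2 + t ^ 2) 0 with h | h
    · rw [h, div_zero]; positivity
    · have : 0 < x ^ 2 + t ^ 2 := lt_of_le_of_ne (by positivity) (Ne.symm h)
      rw [div_le_div_iff₀ this (by positivity)]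
      nlinarith [sq_nonneg (x ^ 2), sq_nonneg t]
  rw [coulsonIntegrand, inv_mul_eq_div, div_le_iff₀ hn]
  calc ∑ i, hH.eigenvalues i ^ 2 / (hH.eigenvalues i ^ 2 + t ^ 2)
      ≤ ∑ i, (1 + t ^ 2)⁻¹ * (1 + hH.eigenvalues i ^ 2) := Finset.sum_le_sum fun i _ => hpt _
    _ = (1 + t ^ 2)⁻¹ * (Fintype.card V + ∑ i, ∑ j, H i j ^ 2) := by
      rw [← Finset.mul_sum, Finset.sum_add_distrib, sum_eigenvalues_sq]; simp
    _ ≤ (1 + t ^ 2)⁻¹ * (Fintype.card V + Fintype.card V) := by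
      refine mul_le_mul_of_nonneg_left (add_le_add_right ?_ _) (by positivity)
      calc ∑ i, ∑ j, H i j ^ 2 ≤ ∑ _i : V, (1 : ℝ) := Finset.sum_le_sum fun i _ => hrow i
        _ = _ := by simp
    _ = _ := by ring

end Energy

/-! ### Convergence in mean of the Wigner energy -/

section Semicircle

/-- Both integrands have the form `1 - t * y`, with `y` the imaginary part of `s` or its limit, so
the factor `t` absorbs the loss in `abs_im_sub_le`. The rate degenerates as `t → 0`, but dominated
convergence needs only pointwise limits. -/
theorem tendsto_expect_coulsonIntegrand (p : I) (hv : 0 < (p : ℝ) * (1 - p)) {t : ℝ} (ht : 0 < t) :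
    Tendsto (fun n : ℕ => expect p (fun Γ : SimpleGraph (Fin n) =>
      |coulsonIntegrand (wigner_isHermitian (p : ℝ) Γ) t
        - semicircleIntegrand ((p : ℝ) * (1 - p)) t|)) atTop (𝓝 0) := by
  have hbound : ∀ n : ℕ, 1 ≤ n → expect p (fun Γ : SimpleGraph (Fin n) =>
      |coulsonIntegrand (wigner_isHermitian (p : ℝ) Γ) t
        - semicircleIntegrand ((p : ℝ) * (1 - p)) t|)
      ≤ (1 / t) * ((1 + 4 / t ^ 2) * (√(n : ℝ))⁻¹ + (1 / t + 2 / t ^ 2) * (n : ℝ)⁻¹) := by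
    intro n hn
    have : Nonempty (Fin n) := ⟨⟨0, hn⟩⟩
    have h := expect_selfConsistent_le (V := Fin n) p ht
    simp only [Fintype.card_fin] at h
    refine le_trans (expect_mono p fun Γ => ?_) h
    have him : 0 ≤ (stieltjes (p : ℝ) t Γ).im := by
      rw [stieltjes, Complex.div_natCast_im, im_trace_resolvent (wigner_isHermitian (p : ℝ) Γ) ht]
      exact div_nonneg (Finset.sum_nonneg fun i _ => by positivity) (Nat.cast_nonneg _)
    have hst := abs_im_sub_le ht hv him
    rw [le_div_iff₀ ht] at hst
    refine le_trans (le_of_eq ?_) hst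
    rw [coulsonIntegrand_eq _ ht, semicircleIntegrand_eq hv, ← abs_of_pos ht, ← abs_mul,
      abs_sub_comm, abs_of_pos ht, stieltjes]
    congr 1
    ring
  have h1 : Tendsto (fun n : ℕ => (√(n : ℝ))⁻¹) atTop (𝓝 0) :=
    (Real.tendsto_sqrt_atTop.comp tendsto_natCast_atTop_atTop).inv_tendsto_atTop
  have h2 : Tendsto (fun n : ℕ => (n : ℝ)⁻¹) atTop (𝓝 0) :=
    tendsto_natCast_atTop_atTop.inv_tendsto_atTop
  have hlim := ((h1.const_mul (1 + 4 / t ^ 2)).add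
    (h2.const_mul (1 / t + 2 / t ^ 2))).const_mul (1 / t)
  simp only [mul_zero, add_zero] at hlim
  refine tendsto_of_tendsto_of_tendsto_of_le_of_le' tendsto_const_nhds hlim
    (Eventually.of_forall fun n => expect_nonneg p fun Γ => abs_nonneg _) ?_
  filter_upwards [eventually_ge_atTop 1] with n hn using hbound n hn

/-- Convergence in mean of the normalised energy of the centred adjacency matrix. -/
theorem tendsto_expect_energy_wigner (p : I) (hv : 0 < (p : ℝ) * (1 - p)) :
    Tendsto (fun n : ℕ => expect p (fun Γ : SimpleGraph (Fin n) =>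
      |energy (wigner (p : ℝ) Γ) (wigner_isHermitian (p : ℝ) Γ) / n
        - 8 / (3 * Real.pi) * √((p : ℝ) * (1 - p))|)) atTop (𝓝 0) := by
  set v : ℝ := p * (1 - p) with hv_def
  set b : (n : ℕ) → SimpleGraph (Fin n) → ℝ → ℝ := fun n Γ =>
    coulsonIntegrand (wigner_isHermitian (p : ℝ) Γ) with hb
  set φ : ℕ → ℝ → ℝ := fun n t => expect p (fun Γ : SimpleGraph (Fin n) =>
      |b n Γ t - semicircleIntegrand v t|) with hφ
  have hbi : ∀ n Γ, IntegrableOn (b n Γ) (Ioi 0) := fun n Γ => integrableOn_coulsonIntegrand _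
  have hsi := integrableOn_semicircleIntegrand hv
  have hdi : ∀ n Γ, IntegrableOn (fun t => |b n Γ t - semicircleIntegrand v t|) (Ioi 0) :=
    fun n Γ => ((hbi n Γ).sub hsi).abs
  have hφi : ∀ n, IntegrableOn (φ n) (Ioi 0) := fun n =>
    integrable_finsetSum _ fun Γ _ => (hdi n Γ).const_mul _
  have hint : Tendsto (fun n => ∫ t in Ioi (0 : ℝ), φ n t) atTop (𝓝 0) := by
    have h := tendsto_integral_of_dominated_convergence (μ := volume.restrict (Ioi 0)) (F := φ)
      (f := fun _ => 0) (fun t => 2 * (1 + t ^ 2)⁻¹ + semicircleIntegrand v t)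
      (fun n => (hφi n).aestronglyMeasurable)
      ((integrable_inv_one_add_sq.integrableOn.const_mul 2).add hsi) ?_ ?_
    · simpa using h
    · intro n
      refine Eventually.of_forall fun t => ?_
      rw [Real.norm_of_nonneg (expect_nonneg p fun Γ => abs_nonneg _),
        ← expect_const (V := Fin n) p (2 * (1 + t ^ 2)⁻¹ + semicircleIntegrand v t)]
      refine expect_mono p fun Γ => ?_
      have h1 := coulsonIntegrand_nonneg (wigner_isHermitian (p : ℝ) Γ) t
      have h2 := coulsonIntegrand_le (wigner_isHermitian (p : ℝ) Γ) (sum_wigner_row_sq_le p Γ) t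
      have h3 := semicircleIntegrand_nonneg hv t
      rw [abs_le]
      constructor <;> simp only [hb] <;> linarith
    · filter_upwards [ae_restrict_mem measurableSet_Ioi] with t ht
      exact tendsto_expect_coulsonIntegrand p hv ht
  have hle : ∀ n : ℕ, expect p (fun Γ : SimpleGraph (Fin n) =>
      |energy (wigner (p : ℝ) Γ) (wigner_isHermitian (p : ℝ) Γ) / n
        - 8 / (3 * Real.pi) * √v|) ≤ 2 / Real.pi * ∫ t in Ioi (0 : ℝ), φ n t := fun n => by
    have hF : ∫ t in Ioi (0 : ℝ), φ n t = expect p (fun Γ : SimpleGraph (Fin n) =>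
        ∫ t in Ioi (0 : ℝ), |b n Γ t - semicircleIntegrand v t|) := by
      simp only [hφ, expect]
      rw [integral_finsetSum _ fun Γ _ => (hdi n Γ).const_mul _]
      simp only [integral_const_mul]
    rw [hF, ← expect_const_mul]
    refine expect_mono p fun Γ => ?_
    have h1 : energy (wigner (p : ℝ) Γ) (wigner_isHermitian (p : ℝ) Γ) / n
        - 8 / (3 * Real.pi) * √v
        = 2 / Real.pi * ∫ t in Ioi (0 : ℝ), (b n Γ t - semicircleIntegrand v t) := by
      rw [integral_sub (hbi n Γ) hsi, integral_coulsonIntegrand, integral_semicircleIntegrand hv,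
        Fintype.card_fin]
      have := Real.pi_pos
      field_simp
      ring
    rw [h1, abs_mul, abs_of_pos (by positivity)]
    exact mul_le_mul_of_nonneg_left abs_integral_le_integral_abs (by positivity)
  have hlim := hint.const_mul (2 / Real.pi)
  rw [mul_zero] at hlim
  exact squeeze_zero (fun n => expect_nonneg p fun Γ => abs_nonneg _) hle hlim

end Semicircle

end WeightedDistance

/-! ### Assembly at scale `n^(7/2)` -/

namespace WeightedDistance

open Matrix SimpleGraph unitInterval MeasureTheory Set Filter Topology

open Classical in
/-- On graphs of diameter at most two the Gutman energy is governed by the energy of the centred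
adjacency matrix and the deviations of the degrees. -/
theorem abs_gutmanEnergy_sub_le (p : I) {n : ℕ} (hn : 1 ≤ n) {Γ : SimpleGraph (Fin n)}
    (hΓ : DiamLeTwo Γ) :
    |gutmanEnergy Γ - (n * p) ^ 2 * √n *
        energy (wigner (p : ℝ) Γ) (wigner_isHermitian (p : ℝ) Γ)|
      ≤ 4 * √n ^ 6 + 2 * √n ^ 3 * ∑ i, |(Γ.degree i : ℝ) - n * p| := by
  have hn0 : (0 : ℝ) < n := by exact_mod_cast hn
  have hN2 : √(n : ℝ) ^ 2 = n := Real.sq_sqrt hn0.le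
  have hp0 := p.2.1
  have hp1 := p.2.2
  have hc : |-(n * (p : ℝ)) ^ 2 * √n| = (n * p) ^ 2 * √n := by
    rw [neg_mul, abs_neg, abs_of_nonneg (by positivity)]
  rw [← hc]
  refine abs_energy_sub_le (gutmanMatrix_isHermitian Γ) _ _ _ fun Q hQ => ?_
  have hW : (-(n * (p : ℝ)) ^ 2 * √n) • wigner (p : ℝ) Γ
      = (-(n * (p : ℝ)) ^ 2) • centered (p : ℝ) Γ := by
    rw [wigner, smul_smul, Fintype.card_fin, mul_assoc,
      mul_inv_cancel₀ (Real.sqrt_pos.2 hn0).ne', mul_one]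
  rw [hW]
  refine abs_trace_weighted_le hQ (b := 2 - p) (by linarith) (by linarith)
    (by rw [Fintype.card_fin, hN2]) (Real.sqrt_nonneg _) (fun i => Nat.cast_nonneg _)
    (fun i => ?_) (by positivity) ?_ (abs_centered_le Γ p) fun i j => ?_
  · rw [hN2]
    have := (Γ.degree_lt_card_verts i).le
    rw [Fintype.card_fin] at this
    exact_mod_cast this
  · rw [hN2]; exact mul_le_of_le_one_right hn0.le hp1
  · rw [gutmanMatrix, of_apply, hΓ.dist_eq (p : ℝ)]
    congr!

open Classical in
/-- The deviation of the Gutman energy from its limit, up to the scale `n ^ (7 / 2)`. -/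
noncomputable def gutmanDeviation (p : I) (n : ℕ) (Γ : SimpleGraph (Fin n)) : ℝ :=
  4 * √n ^ 6 + 2 * √n ^ 3 * ∑ i, |(Γ.degree i : ℝ) - n * p|
    + √n ^ 7 * |energy (wigner (p : ℝ) Γ) (wigner_isHermitian (p : ℝ) Γ) / n
        - 8 / (3 * Real.pi) * √((p : ℝ) * (1 - p))|

open Classical in
theorem gutmanDeviation_nonneg (p : I) (n : ℕ) (Γ : SimpleGraph (Fin n)) :
    0 ≤ gutmanDeviation p n Γ := by
  rw [gutmanDeviation]
  have : 0 ≤ ∑ i, |(Γ.degree i : ℝ) - n * p| := Finset.sum_nonneg fun _ _ => abs_nonneg _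
  positivity

theorem rpow_seven_half (n : ℕ) : (n : ℝ) ^ (7 / 2 : ℝ) = √n ^ 7 := by
  rw [Real.sqrt_eq_rpow, ← Real.rpow_natCast, ← Real.rpow_mul (Nat.cast_nonneg n)]
  norm_num

theorem abs_gutmanEnergy_sub_limit_le (p : I) {n : ℕ} (hn : 1 ≤ n) {Γ : SimpleGraph (Fin n)}
    (hΓ : DiamLeTwo Γ) :
    |gutmanEnergy Γ - 8 / (3 * Real.pi) * (p : ℝ) ^ 2 * √((p : ℝ) * (1 - p))
        * (n : ℝ) ^ (7 / 2 : ℝ)| ≤ gutmanDeviation p n Γ := by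
  have hn0 : (0 : ℝ) < n := by exact_mod_cast hn
  have hp0 := p.2.1
  have hp1 := p.2.2
  have h := abs_gutmanEnergy_sub_le p hn hΓ
  set E := energy (wigner (p : ℝ) Γ) (wigner_isHermitian (p : ℝ) Γ) with hE
  set c := 8 / (3 * Real.pi) * √((p : ℝ) * (1 - p)) with hc
  have h2 : |(n * (p : ℝ)) ^ 2 * √n * E - (p : ℝ) ^ 2 * c * √n ^ 7| ≤ √n ^ 7 * |E / n - c| := by
    have hN2 : √(n : ℝ) ^ 2 = n := Real.sq_sqrt hn0.le
    have e : (n * (p : ℝ)) ^ 2 * √n * E - (p : ℝ) ^ 2 * c * √n ^ 7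
        = (p : ℝ) ^ 2 * (√n ^ 7 * (E / n - c)) := by
      have : √(n : ℝ) ^ 7 = n ^ 3 * √n := by
        rw [show √(n : ℝ) ^ 7 = (√(n : ℝ) ^ 2) ^ 3 * √n by ring, hN2]
      rw [this]
      field_simp
    rw [e, abs_mul, abs_mul, abs_of_nonneg (by positivity : (0 : ℝ) ≤ √n ^ 7),
      abs_of_nonneg (sq_nonneg _)]
    exact mul_le_of_le_one_left (by positivity) (pow_le_one₀ hp0 hp1)
  have e3 : gutmanEnergy Γ - 8 / (3 * Real.pi) * (p : ℝ) ^ 2 * √((p : ℝ) * (1 - p))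
        * (n : ℝ) ^ (7 / 2 : ℝ)
      = (gutmanEnergy Γ - (n * p) ^ 2 * √n * E)
        + ((n * (p : ℝ)) ^ 2 * √n * E - (p : ℝ) ^ 2 * c * √n ^ 7) := by
    rw [rpow_seven_half, hc]; ring
  rw [e3, gutmanDeviation]
  exact (abs_add_le _ _).trans (add_le_add h h2)

/-- The comparison error and the degree term each have mean at most `4 * √n ^ 6`, half a power of
`n` below the target scale. -/
theorem expect_gutmanDeviation_div_le (p : I) {n : ℕ} (hn : 1 ≤ n) :
    expect p (gutmanDeviation p n) / √n ^ 7 ≤ 8 * (√n)⁻¹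
      + expect p (fun Γ : SimpleGraph (Fin n) =>
        |energy (wigner (p : ℝ) Γ) (wigner_isHermitian (p : ℝ) Γ) / n
          - 8 / (3 * Real.pi) * √((p : ℝ) * (1 - p))|) := by
  classical
  have hn0 : (0 : ℝ) < n := by exact_mod_cast hn
  have hN : 0 < √(n : ℝ) := Real.sqrt_pos.2 hn0
  have hN1 : 1 ≤ √(n : ℝ) := Real.one_le_sqrt.2 (by exact_mod_cast hn)
  have hdeg : expect p (fun Γ : SimpleGraph (Fin n) => ∑ i, |(Γ.degree i : ℝ) - n * p|)
      ≤ √n ^ 2 * (√n + 1) := by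
    rw [expect_sum, Real.sq_sqrt hn0.le]
    calc _ ≤ ∑ _i : Fin n, (√(n : ℝ) + 1) := Finset.sum_le_sum fun i _ => by
          simpa only [Fintype.card_fin] using expect_abs_degree_sub_le p i
      _ = _ := by simp; ring
  unfold gutmanDeviation
  rw [expect_add, expect_add, expect_const, expect_const_mul, expect_const_mul, div_le_iff₀
    (by positivity), add_mul, mul_comm (expect p _) (√(n : ℝ) ^ 7)]
  refine add_le_add_left ?_ _
  calc 4 * √(n : ℝ) ^ 6 + 2 * √n ^ 3 * expect p (fun Γ : SimpleGraph (Fin n) =>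
          ∑ i, |(Γ.degree i : ℝ) - n * p|)
      ≤ 4 * √(n : ℝ) ^ 6 + 2 * √n ^ 3 * (√n ^ 2 * (√n + √n)) := by
        refine add_le_add_right (mul_le_mul_of_nonneg_left (hdeg.trans ?_) (by positivity)) _
        exact mul_le_mul_of_nonneg_left (add_le_add_right hN1 _) (by positivity)
    _ = 8 * (√n)⁻¹ * √n ^ 7 := by field_simp; ring

theorem tendsto_measureReal_not_diamLeTwo (p : I) (hp : 0 < (p : ℝ)) :
    Tendsto (fun n : ℕ => (binomialRandom (Fin n) p).real {Γ | ¬ DiamLeTwo Γ}) atTop (𝓝 0) := by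
  have hp1 := p.2.2
  have hlim : Tendsto (fun n : ℕ => (n : ℝ) ^ 2 * (1 - (p : ℝ) ^ 2) ^ (n - 2)) atTop (𝓝 0) := by
    -- Shifting by `2` removes the truncated subtraction; then `(n + 2)² = n² + 4n + 4`.
    rw [← tendsto_add_atTop_iff_nat 2]
    have hr0 : 0 ≤ 1 - (p : ℝ) ^ 2 := by nlinarith
    have hr : |1 - (p : ℝ) ^ 2| < 1 := by
      rw [abs_of_nonneg hr0]; nlinarith
    have h0 := tendsto_pow_const_mul_const_pow_of_abs_lt_one 0 hr
    have h1 := tendsto_pow_const_mul_const_pow_of_abs_lt_one 1 hr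
    have h2 := tendsto_pow_const_mul_const_pow_of_abs_lt_one 2 hr
    have h := (h2.add (h1.const_mul 4)).add (h0.const_mul 4)
    simp only [mul_zero, add_zero] at h
    refine h.congr fun n => ?_
    rw [Nat.add_sub_cancel]
    push_cast
    ring
  refine squeeze_zero (fun n => measureReal_nonneg) (fun n => ?_) hlim
  simpa only [Fintype.card_fin] using measureReal_not_diamLeTwo_le (V := Fin n) p

theorem tendsto_measureReal_gutmanEnergy_compl (p : I) (hp0 : 0 < (p : ℝ)) (hp1 : (p : ℝ) < 1)
    {ε : ℝ} (hε : 0 < ε) :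
    Tendsto (fun n : ℕ => (binomialRandom (Fin n) p).real {Γ : SimpleGraph (Fin n) |
      |gutmanEnergy Γ - 8 / (3 * Real.pi) * (p : ℝ) ^ 2 * √((p : ℝ) * (1 - p))
        * (n : ℝ) ^ (7 / 2 : ℝ)| ≤ ε * (n : ℝ) ^ (7 / 2 : ℝ)}ᶜ) atTop (𝓝 0) := by
  have hv : 0 < (p : ℝ) * (1 - p) := mul_pos hp0 (by linarith)
  have h1 : Tendsto (fun n : ℕ => (√(n : ℝ))⁻¹) atTop (𝓝 0) :=
    (Real.tendsto_sqrt_atTop.comp tendsto_natCast_atTop_atTop).inv_tendsto_atTop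
  have hlim := (tendsto_measureReal_not_diamLeTwo p hp0).add
    (((h1.const_mul 8).add (tendsto_expect_energy_wigner p hv)).div_const ε)
  simp only [mul_zero, add_zero, zero_div] at hlim
  refine tendsto_of_tendsto_of_tendsto_of_le_of_le' tendsto_const_nhds hlim
    (Eventually.of_forall fun n => measureReal_nonneg) ?_
  filter_upwards [eventually_ge_atTop 1] with n hn
  have hN : 0 < √(n : ℝ) := Real.sqrt_pos.2 (by exact_mod_cast hn)
  have hsub : {Γ : SimpleGraph (Fin n) |
      |gutmanEnergy Γ - 8 / (3 * Real.pi) * (p : ℝ) ^ 2 * √((p : ℝ) * (1 - p))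
        * (n : ℝ) ^ (7 / 2 : ℝ)| ≤ ε * (n : ℝ) ^ (7 / 2 : ℝ)}ᶜ
      ⊆ {Γ | ¬ DiamLeTwo Γ} ∪ {Γ | ε * √n ^ 7 < gutmanDeviation p n Γ} := fun Γ hΓ => by
    by_cases hd : DiamLeTwo Γ
    · right
      rw [mem_compl_iff, mem_ofPred_eq, not_le, rpow_seven_half] at hΓ
      have := abs_gutmanEnergy_sub_limit_le p hn hd
      rw [rpow_seven_half] at this
      exact lt_of_lt_of_le hΓ this
    · exact Or.inl hd
  refine (measureReal_mono hsub).trans ((measureReal_union_le _ _).trans (add_le_add_right ?_ _))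
  refine (measureReal_le_expect_div p (gutmanDeviation_nonneg p n) (by positivity)).trans ?_
  rw [mul_comm, ← div_div]
  exact div_le_div_of_nonneg_right (expect_gutmanDeviation_div_le p hn) hε.le

end WeightedDistance

theorem corollary3p7 (p : ℝ) (hp : p ∈ Set.Ioo (0 : ℝ) 1) :
    ∀ ε : ℝ, 0 < ε →
      Filter.Tendsto
        (fun n : ℕ =>
          SimpleGraph.binomialRandom (Fin n) ⟨p, Set.Ioo_subset_Icc_self hp⟩
            {G : SimpleGraph (Fin n) |
              |WeightedDistance.gutmanEnergy G
                  - 8 / (3 * Real.pi) * p ^ 2 * Real.sqrt (p * (1 - p)) * (n : ℝ) ^ (7 / 2 : ℝ)|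
                ≤ ε * (n : ℝ) ^ (7 / 2 : ℝ)})
        Filter.atTop (nhds 1) := by
  intro ε hε
  have h := WeightedDistance.tendsto_measureReal_gutmanEnergy_compl
    ⟨p, Set.Ioo_subset_Icc_self hp⟩ hp.1 hp.2 hε
  have h2 := ENNReal.tendsto_ofReal (h.const_sub 1)
  rw [sub_zero, ENNReal.ofReal_one] at h2
  refine h2.congr fun n => ?_
  rw [MeasureTheory.probReal_compl_eq_one_sub (Set.toFinite _).measurableSet, sub_sub_cancel,
    MeasureTheory.ofReal_measureReal]
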